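/- **Theorem (well-posedness for the critical stationary quasi-geostrophic equation).** *Setting.* Fix a homogeneous Littlewood–Paley decomposition of $\mathbb{R}^2$: $\widehat{\phi_j}(\xi)=\widehat{\phi_0}(2^{-j}\xi)$, where $\widehat{\phi_0}$ is smooth, real-valued, radial, supported in $\{1/2\le|\xi|\le 2\}$, and $\sum_{j\in\mathbb{Z}}\widehat{\phi_j}(\xi)=1$ for $\xi\ne 0$. For $1\le p<\infty$ and $s\le 2/p$ let $$\dot B^{s}_{p,1}(\mathbb{R}^2)=\Big\{u\in\mathscr{S}'(\mathbb{R}^2)\ ;\ \sum_{j\in\mathbb{Z}}\phi_j*u=u \text{ in } \mathscr{S}'(\mathbb{R}^2),\ \ \|u\|_{\dot B^{s}_{p,1}}:=\sum_{j\in\mathbb{Z}}2^{sj}\|\phi_j*u\|_{L^p}<\infty\Big\}.$$ Distributions are complex-valued. For a symbol $m$ smooth on $\mathbb{R}^2\setminus\{0\}$, $m(D)u:=\sum_{j\in\mathbb{Z}}\mathscr{F}^{-1}(m\,\widehat{\phi_j}\,\mathscr{F}u)$ in $\mathscr{S}'$; in particular $(-\Delta)^{1/2}$ has the symbol $|\xi|$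 and $\nabla^{\perp}(-\Delta)^{-1/2}$ has the symbol $(i\xi_2,-i\xi_1)/|\xi|$ (for the Fourier transform with kernel $e^{-ix\cdot\xi}$). A solution $\theta\in\dot B^{2/p}_{p,1}(\mathbb{R}^2)$ of $$(-\Delta)^{1/2}\theta+v\cdot\nabla\theta=f,\qquad v=\nabla^{\perp}(-\Delta)^{-1/2}\theta\qquad\text{in }\mathbb{R}^2,\qquad\nabla^\perp=(\partial_{x_2},-\partial_{x_1}),$$ is one for which $\theta$ and $v$ are bounded functions and the equation holds in $\mathscr{S}'(\mathbb{R}^2)$, where $v\cdot\nabla\theta=\operatorname{div}(\theta v)$ (recall $\operatorname{div}v=0$), i.e. for every Schwartz function $g$ $$\langle(-\Delta)^{1/2}\theta,g\rangle-\int_{\mathbb{R}^2}\theta\, v\cdot\nabla g\,dx=\langle f,g\rangle .$$ *Statement.* Let $1\le p<\infty$. There are constants $\delta,\eta>0$ and $L\ge 0$, depending only on $p$ (and on the fixed Littlewood–Paley decomposition), such that: 1. for every $f\in\dot B^{2/p-1}_{p,1}(\mathbb{R}^2)$ with $\|f\|_{\dot B^{2/p-1}_{p,1}}\le\delta$ there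 is exactly one solution $\theta=:S(f)\in\dot B^{2/p}_{p,1}(\mathbb{R}^2)$ with $\|\theta\|_{\dot B^{2/p}_{p,1}}\le\eta$; 2. the data-to-solution map $S$ is Lipschitz continuous: for all $f_1,f_2\in\dot B^{2/p-1}_{p,1}(\mathbb{R}^2)$ of norm at most $\delta$, $$\|S(f_1)-S(f_2)\|_{\dot B^{2/p}_{p,1}}\le L\,\|f_1-f_2\|_{\dot B^{2/p-1}_{p,1}};$$ 3. if $f$ is real-valued, then so is $S(f)$. -/

import Mathlib

open MeasureTheory
open scoped SchwartzMap ENNReal NNReal ContDiff LineDeriv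

/-- The plane `ℝ²` with its Euclidean norm. -/
abbrev Plane : Type := EuclideanSpace ℝ (Fin 2)

/-- The generating function of a homogeneous Littlewood--Paley decomposition of `ℝ²`: a smooth
radial function supported in the annulus `1/2 ≤ |ξ| ≤ 2` whose dyadic dilates sum up to one away
from the origin. -/
structure LittlewoodPaley where
  /-- the profile `φ̂₀` on the frequency side -/
  profile : Plane → ℝ
  smooth : ContDiff ℝ ∞ profile
  radial : ∀ ξ ζ : Plane, ‖ξ‖ = ‖ζ‖ → profile ξ = profile ζ
  annulus : ∀ ξ : Plane, profile ξ ≠ 0 → 1 / 2 ≤ ‖ξ‖ ∧ ‖ξ‖ ≤ 2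
  partition : ∀ ξ : Plane, ξ ≠ 0 → HasSum (fun j : ℤ => profile ((2 : ℝ) ^ (-j) • ξ)) 1

namespace LittlewoodPaley

/-- `φ̂_j(ξ) = φ̂₀(2^{-j} ξ)`. -/
noncomputable def symbol (φ : LittlewoodPaley) (j : ℤ) (ξ : Plane) : ℂ :=
  (φ.profile ((2 : ℝ) ^ (-j) • ξ) : ℂ)

theorem symbol_eq_zero (φ : LittlewoodPaley) (j : ℤ) {ξ : Plane}
    (h : ‖ξ‖ < (2 : ℝ) ^ j / 2 ∨ (2 : ℝ) ^ j * 2 < ‖ξ‖) : φ.symbol j ξ = 0 := by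
  by_contra hne
  have hp : φ.profile ((2 : ℝ) ^ (-j) • ξ) ≠ 0 := by
    intro h0
    exact hne (by rw [symbol, h0, Complex.ofReal_zero])
  have hj : (0 : ℝ) < (2 : ℝ) ^ j := by positivity
  obtain ⟨h1, h2⟩ := φ.annulus _ hp
  rw [norm_smul, Real.norm_of_nonneg (by positivity), zpow_neg, inv_mul_eq_div] at h1 h2
  rw [le_div_iff₀ hj] at h1
  rw [div_le_iff₀ hj] at h2
  rcases h with h | h <;> linarith

/-- If `m` is smooth away from the origin, then `m φ̂_j` is a smooth function with compact support;
in particular it is an admissible symbol for Mathlib's Fourier multipliers. -/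
theorem hasTemperateGrowth_mul_symbol (φ : LittlewoodPaley) (j : ℤ) {m : Plane → ℂ}
    (hm : ContDiffOn ℝ ∞ m {0}ᶜ) :
    (fun ξ => m ξ * φ.symbol j ξ).HasTemperateGrowth := by
  have hj : (0 : ℝ) < (2 : ℝ) ^ j := by positivity
  have hs : ContDiff ℝ ∞ (φ.symbol j) := by
    have := φ.smooth.comp (contDiff_const_smul (𝕜 := ℝ) (n := ∞) (F := Plane) ((2 : ℝ) ^ (-j)))
    exact Complex.ofRealCLM.contDiff.comp this
  have hsmooth : ContDiff ℝ ∞ (fun ξ => m ξ * φ.symbol j ξ) := by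
    rw [contDiff_iff_contDiffAt]
    intro ξ
    by_cases h : ξ = 0
    · subst h
      refine (contDiffAt_const (c := (0 : ℂ))).congr_of_eventuallyEq ?_
      filter_upwards [Metric.ball_mem_nhds (0 : Plane) (half_pos hj)] with ζ hζ
      rw [φ.symbol_eq_zero j (Or.inl (by simpa using hζ)), mul_zero]
    · exact (hm.contDiffAt (isOpen_compl_singleton.mem_nhds h)).mul hs.contDiffAt
  have hc : HasCompactSupport (fun ξ => m ξ * φ.symbol j ξ) := by
    refine HasCompactSupport.of_support_subset_isCompact
      (isCompact_closedBall (0 : Plane) ((2 : ℝ) ^ j * 2)) ?_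
    intro ξ hξ
    by_contra hn
    apply hξ
    have : (2 : ℝ) ^ j * 2 < ‖ξ‖ := by simpa using hn
    simp only [φ.symbol_eq_zero j (Or.inr this), mul_zero]
  exact (hc.toSchwartzMap hsmooth).hasTemperateGrowth

/-- Littlewood--Paley decompositions exist. -/
theorem nonempty : Nonempty LittlewoodPaley := by
  let χ : Plane → ℝ := fun ξ => Real.smoothTransition ((4 - ‖ξ‖ ^ 2) / 3)
  have χ1 : ∀ ξ : Plane, ‖ξ‖ ≤ 1 → χ ξ = 1 := fun ξ h =>
    Real.smoothTransition.one_of_one_le (by nlinarith [norm_nonneg ξ])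
  have χ0 : ∀ ξ : Plane, 2 ≤ ‖ξ‖ → χ ξ = 0 := fun ξ h =>
    Real.smoothTransition.zero_of_nonpos (by nlinarith [norm_nonneg ξ])
  have χs : ContDiff ℝ ∞ χ :=
    Real.smoothTransition.contDiff.comp
      ((contDiff_const.sub (contDiff_norm_sq ℝ)).div_const 3)
  refine ⟨⟨fun ξ => χ ξ - χ ((2 : ℝ) • ξ), ?_, ?_, ?_, ?_⟩⟩
  · exact χs.sub (χs.comp (contDiff_const_smul (2 : ℝ)))
  · intro ξ ζ h
    simp only [χ, norm_smul, h]
  · intro ξ h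
    have n2 : ‖(2 : ℝ) • ξ‖ = 2 * ‖ξ‖ := by rw [norm_smul]; norm_num
    constructor
    · by_contra! hlt
      apply h
      simp only [χ1 ξ (by linarith), χ1 ((2 : ℝ) • ξ) (by linarith), sub_self]
    · by_contra! hlt
      apply h
      simp only [χ0 ξ (by linarith), χ0 ((2 : ℝ) • ξ) (by linarith), sub_self]
  · intro ξ hξ
    have hpos : 0 < ‖ξ‖ := norm_pos_iff.mpr hξ
    let a : ℤ → ℝ := fun j => χ ((2 : ℝ) ^ (-j) • ξ)
    have na : ∀ j : ℤ, ‖(2 : ℝ) ^ (-j) • ξ‖ = ‖ξ‖ / (2 : ℝ) ^ j := by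
      intro j
      rw [norm_smul, Real.norm_of_nonneg (by positivity), zpow_neg, inv_mul_eq_div]
    obtain ⟨n1, hn1⟩ := pow_unbounded_of_one_lt ‖ξ‖ (one_lt_two (α := ℝ))
    obtain ⟨n2, hn2⟩ := pow_unbounded_of_one_lt (2 / ‖ξ‖) (one_lt_two (α := ℝ))
    have ha1 : ∀ j : ℤ, (n1 : ℤ) ≤ j → a j = 1 := by
      intro j hj
      apply χ1
      rw [na, div_le_one (by positivity)]
      have : (2 : ℝ) ^ (n1 : ℤ) ≤ 2 ^ j := zpow_le_zpow_right₀ one_le_two hj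
      rw [zpow_natCast] at this
      linarith
    have ha0 : ∀ j : ℤ, j ≤ -(n2 : ℤ) → a j = 0 := by
      intro j hj
      apply χ0
      rw [na, le_div_iff₀ (by positivity)]
      have : (2 : ℝ) ^ j ≤ 2 ^ (-(n2 : ℤ)) := zpow_le_zpow_right₀ one_le_two hj
      rw [zpow_neg, zpow_natCast] at this
      have h2 : 2 < 2 ^ n2 * ‖ξ‖ := by rwa [div_lt_iff₀ hpos] at hn2
      have h3 : (2 : ℝ) * 2 ^ j ≤ 2 * (2 ^ n2)⁻¹ := by linarith
      refine h3.trans ?_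
      rw [← div_eq_mul_inv, div_le_iff₀ (by positivity)]
      linarith
    have key : ∀ j : ℤ, χ ((2 : ℝ) ^ (-j) • ξ) - χ ((2 : ℝ) • (2 : ℝ) ^ (-j) • ξ)
        = a j - a (j - 1) := by
      intro j
      simp only [a, smul_smul]
      congr 3
      rw [neg_sub, sub_eq_add_neg, zpow_add₀ two_ne_zero, zpow_one]
    simp only [key]
    set n : ℕ := n1 + n2 with hn
    have hsum : ∑ k ∈ Finset.range (2 * n),
        (a ((k : ℤ) + 1 - n) - a ((k : ℤ) + 1 - n - 1)) = 1 := by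
      have h := Finset.sum_range_sub (fun k : ℕ => a ((k : ℤ) - n)) (2 * n)
      have e1 : a (((2 * n : ℕ) : ℤ) - n) = 1 := ha1 _ (by push_cast; omega)
      have e0 : a (((0 : ℕ) : ℤ) - n) = 0 := ha0 _ (by push_cast; omega)
      rw [e1, e0, sub_zero] at h
      rw [← h]
      refine Finset.sum_congr rfl fun k _ => ?_
      congr 2
      omega
    let e : ℕ ↪ ℤ := ⟨fun k => (k : ℤ) + 1 - n, fun x y h => by
      have h' : (x : ℤ) + 1 - n = (y : ℤ) + 1 - n := h
      omega⟩
    have hmap : ∑ j ∈ (Finset.range (2 * n)).map e, (a j - a (j - 1)) = 1 := by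
      rw [Finset.sum_map]
      exact hsum
    rw [← hmap]
    apply hasSum_sum_of_ne_finset_zero
    intro j hj
    by_cases hlow : j ≤ -(n : ℤ)
    · rw [ha0 j (by omega), ha0 (j - 1) (by omega), sub_zero]
    · by_cases hhigh : (n : ℤ) + 1 ≤ j
      · rw [ha1 j (by omega), ha1 (j - 1) (by omega), sub_self]
      · exfalso
        apply hj
        rw [Finset.mem_map]
        refine ⟨(j + n - 1).toNat, ?_, ?_⟩
        · rw [Finset.mem_range]; omega
        · change (((j + n - 1).toNat : ℕ) : ℤ) + 1 - n = j
          omega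

/-- The frequency-localized piece `𝓕⁻¹ (m φ̂_j 𝓕 u)` of `m(D) u`. -/
noncomputable def localized (φ : LittlewoodPaley) (m : Plane → ℂ) (j : ℤ) (u : 𝓢'(Plane, ℂ)) :
    𝓢'(Plane, ℂ) :=
  TemperedDistribution.fourierMultiplierCLM ℂ (fun ξ => m ξ * φ.symbol j ξ) u

/-- The Littlewood--Paley block `φ_j * u = 𝓕⁻¹ (φ̂_j 𝓕 u)`. -/
noncomputable def block (φ : LittlewoodPaley) (j : ℤ) (u : 𝓢'(Plane, ℂ)) : 𝓢'(Plane, ℂ) :=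
  TemperedDistribution.fourierMultiplierCLM ℂ (φ.symbol j) u

end LittlewoodPaley

/-- The `L^p` norm of a tempered distribution; it is `∞` if the distribution is not given by an
`L^p` function (an `L^p` function representing a distribution is unique). -/
noncomputable def distLpNorm (p : ℝ≥0∞) [Fact (1 ≤ p)] (u : 𝓢'(Plane, ℂ)) : ℝ≥0∞ :=
  ⨅ (U : Lp ℂ p (volume : Measure Plane)) (_ : (U : 𝓢'(Plane, ℂ)) = u), ‖U‖ₑ

/-- The homogeneous Besov norm with summation index one:
`‖u‖ = ∑_{j ∈ ℤ} 2^{sj} ‖φ_j * u‖_{L^p}`. -/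
noncomputable def besovNorm (φ : LittlewoodPaley) (s : ℝ) (p : ℝ≥0∞) [Fact (1 ≤ p)]
    (u : 𝓢'(Plane, ℂ)) : ℝ≥0∞ :=
  ∑' j : ℤ, ENNReal.ofReal ((2 : ℝ) ^ (s * (j : ℝ))) * distLpNorm p (φ.block j u)

/-- The homogeneous Besov space `Ḃ^s_{p,1}(ℝ²)` for `s ≤ 2/p`, realized as a space of tempered
distributions: `∑_{j ∈ ℤ} φ_j * u = u` in `𝓢'` and the Besov norm is finite. -/
def MemBesov (φ : LittlewoodPaley) (s : ℝ) (p : ℝ≥0∞) [Fact (1 ≤ p)] (u : 𝓢'(Plane, ℂ)) : Prop :=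
  HasSum (fun j : ℤ => φ.block j u) u ∧ besovNorm φ s p u < ⊤

/-- `w = m(D) u = 𝓕⁻¹ (m 𝓕 u)` for a symbol `m` that is smooth away from the origin but possibly
singular at the origin: `w` is the sum in `𝓢'` of the frequency-localized pieces of `m(D) u`. -/
def IsMultiplier (φ : LittlewoodPaley) (m : Plane → ℂ) (u w : 𝓢'(Plane, ℂ)) : Prop :=
  HasSum (fun j : ℤ => φ.localized m j u) w

/-- The symbol of `(-Δ)^α`. As Mathlib's Fourier transform has the kernel `exp(-2πi x·ξ)`, the
symbol of `-Δ` is `(2π|ξ|)²`. -/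
noncomputable def fracLaplacianSymbol (α : ℝ) (ξ : Plane) : ℂ :=
  (((2 * Real.pi * ‖ξ‖) ^ (2 * α) : ℝ) : ℂ)

/-- The symbol of the partial derivative in the `k`-th coordinate. -/
noncomputable def partialSymbol (k : Fin 2) (ξ : Plane) : ℂ :=
  2 * Real.pi * Complex.I * (ξ k : ℂ)

/-- The symbols of the two components of `∇^⊥ (-Δ)^{-1/2}`, where `∇^⊥ = (∂₂, -∂₁)`. -/
noncomputable def velocitySymbol (k : Fin 2) (ξ : Plane) : ℂ :=
  ![partialSymbol 1 ξ, -partialSymbol 0 ξ] k * fracLaplacianSymbol (-(1 / 2)) ξ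

theorem contDiffOn_fracLaplacianSymbol (α : ℝ) :
    ContDiffOn ℝ ∞ (fracLaplacianSymbol α) {0}ᶜ := by
  intro ξ hξ
  have h0 : ‖ξ‖ ≠ 0 := norm_ne_zero_iff.mpr hξ
  have h1 : ContDiffAt ℝ ∞ (fun ζ : Plane => (2 * Real.pi * ‖ζ‖) ^ (2 * α)) ξ :=
    (contDiffAt_const.mul (contDiffAt_norm ℝ hξ)).rpow_const_of_ne
      (by have := Real.pi_pos; positivity)
  exact (Complex.ofRealCLM.contDiff.contDiffAt.comp ξ h1).contDiffWithinAt

theorem contDiff_partialSymbol (k : Fin 2) : ContDiff ℝ ∞ (partialSymbol k) := by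
  have h : ContDiff ℝ ∞ (fun ξ : Plane => ξ k) := by fun_prop
  exact contDiff_const.mul (Complex.ofRealCLM.contDiff.comp h)

theorem contDiffOn_velocitySymbol (k : Fin 2) : ContDiffOn ℝ ∞ (velocitySymbol k) {0}ᶜ := by
  have h0 := (contDiff_partialSymbol 0).contDiffOn (s := {0}ᶜ)
  have h1 := (contDiff_partialSymbol 1).contDiffOn (s := {0}ᶜ)
  have hf := contDiffOn_fracLaplacianSymbol (-(1 / 2))
  fin_cases k
  · exact h1.mul hf
  · exact h0.neg.mul hf

/-- `θ` solves the stationary quasi-geostrophic equation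
`(-Δ)^α θ + v · ∇θ = f`, `v = ∇^⊥ (-Δ)^{-1/2} θ`, in the sense of tempered distributions.
Here `Λ = (-Δ)^α θ`, and `Θ`, `V 0`, `V 1` are the bounded functions that represent `θ` and the two
components of `v`. Since `div v = 0`, the nonlinear term is `v · ∇θ = div (θ v)`, that is,
`⟨v · ∇θ, g⟩ = -∫ θ v · ∇g` for test functions `g`. -/
def IsQGSolution (φ : LittlewoodPaley) (α : ℝ) (f θ : 𝓢'(Plane, ℂ)) : Prop :=
  ∃ (Λ : 𝓢'(Plane, ℂ)) (Θ : Lp ℂ ⊤ (volume : Measure Plane))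
    (V : Fin 2 → Lp ℂ ⊤ (volume : Measure Plane)),
    IsMultiplier φ (fracLaplacianSymbol α) θ Λ ∧
    (Θ : 𝓢'(Plane, ℂ)) = θ ∧
    (∀ k, IsMultiplier φ (velocitySymbol k) θ (V k : 𝓢'(Plane, ℂ))) ∧
    ∀ g : 𝓢(Plane, ℂ),
      Λ g - ∫ x, Θ x * ∑ k, V k x * (∂_{EuclideanSpace.single k (1 : ℝ)} g) x = f g

/-- A tempered distribution is real-valued if it is real on real test functions. -/
def IsRealDistribution (u : 𝓢'(Plane, ℂ)) : Prop :=
  ∀ g : 𝓢(Plane, ℂ), (∀ x, (g x).im = 0) → (u g).im = 0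

/-! ### The `L^p` norm of a tempered distribution -/

section DistLpNorm

variable {p : ℝ≥0∞} [Fact (1 ≤ p)]

/-! Applying `(-Δ)^{-1/2}` turns the equation into `θ = y - Q(θ, θ)` with `y = (-Δ)^{-1/2} f` and
`Q(u, w) = ∑ₖ ∂ₖ(-Δ)^{-1/2}(u · vₖ(w))`, where `v(w) = ∇^⊥(-Δ)^{-1/2} w`. The divergence form of the
nonlinearity is decisive: its derivative is compensated by `(-Δ)^{-1/2}`, so `Q` consists only of
order-zero multipliers and one product. In the Banach space `E = Ḃ^{2/p}_{p,1}` the map `Q` is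
bounded, and a small-data contraction gives the solution.

Three facts carry this. First, by Bernstein and the `ℓ¹` summation, `E` embeds into `L^∞`
(`exists_rep_top_of_memBesov`), so its elements can be multiplied, and series that converge
absolutely in norm converge in `𝓢'`. Second, a multiplier that is homogeneous of degree `d` maps
`Ḃ^{d+2/p}_{p,1}` to `E` (`exists_isMultiplier`): up to the factor `2^{dj}`, its pieces are dilates
of one Schwartz symbol. Third, `E` is an algebra (`exists_besovNorm_mul_le`). No paraproduct is
needed: for `k ≤ j` the product of the blocks `θ_j v_k` has frequencies at most of order `2^j`, so,
as `2/p > 0`, a geometric series bounds its norm in `E` by `2^{2j/p} ‖θ_j‖_p ‖v_k‖_∞`, and Bernstein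
turns this into a term of the norm of `θ` times a term of the norm of `v`. The double sum
factorizes.

The condition `∑ φ_j * u = u` excludes polynomials and has to be checked for every object built
along the way; it also justifies inverting `(-Δ)^{1/2}` in `isQGSolution_iff`.

Subtracting two fixed-point equations and absorbing the quadratic term gives the Lipschitz bound,
and uniqueness is its case of equal data. Real data give real solutions because the conjugate of a
solution solves the conjugate equation. -/

theorem toTemperedDistribution_injective {U V : Lp ℂ p (volume : Measure Plane)}
    (h : (U : 𝓢'(Plane, ℂ)) = V) : U = V := by
  have hker := Lp.ker_toTemperedDistributionCLM_eq_bot (F := ℂ) (μ := (volume : Measure Plane))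
    (p := p)
  exact LinearMap.ker_eq_bot.mp hker h

theorem toTemperedDistribution_add (U V : Lp ℂ p (volume : Measure Plane)) :
    ((U + V : Lp ℂ p (volume : Measure Plane)) : 𝓢'(Plane, ℂ)) = (U : 𝓢'(Plane, ℂ)) + V :=
  map_add (Lp.toTemperedDistributionCLM ℂ (volume : Measure Plane) p) U V

theorem toTemperedDistribution_sub (U V : Lp ℂ p (volume : Measure Plane)) :
    ((U - V : Lp ℂ p (volume : Measure Plane)) : 𝓢'(Plane, ℂ)) = (U : 𝓢'(Plane, ℂ)) - V :=
  map_sub (Lp.toTemperedDistributionCLM ℂ (volume : Measure Plane) p) U V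

theorem toTemperedDistribution_neg (U : Lp ℂ p (volume : Measure Plane)) :
    ((-U : Lp ℂ p (volume : Measure Plane)) : 𝓢'(Plane, ℂ)) = -(U : 𝓢'(Plane, ℂ)) :=
  map_neg (Lp.toTemperedDistributionCLM ℂ (volume : Measure Plane) p) U

theorem toTemperedDistribution_zero :
    ((0 : Lp ℂ p (volume : Measure Plane)) : 𝓢'(Plane, ℂ)) = 0 :=
  map_zero (Lp.toTemperedDistributionCLM ℂ (volume : Measure Plane) p)

theorem hasSum_toTemperedDistribution {ι : Type*} {U : ι → Lp ℂ p (volume : Measure Plane)}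
    {V : Lp ℂ p (volume : Measure Plane)} (h : HasSum U V) :
    HasSum (fun i => (U i : 𝓢'(Plane, ℂ))) (V : 𝓢'(Plane, ℂ)) :=
  (Lp.toTemperedDistributionCLM ℂ (volume : Measure Plane) p).hasSum h

theorem distLpNorm_coe (U : Lp ℂ p (volume : Measure Plane)) :
    distLpNorm p (U : 𝓢'(Plane, ℂ)) = ‖U‖ₑ := by
  refine le_antisymm (iInf₂_le (f := fun (V : Lp ℂ p (volume : Measure Plane))
    (_ : (V : 𝓢'(Plane, ℂ)) = U) => ‖V‖ₑ) U rfl) (le_iInf₂ fun V hV => ?_)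
  rw [toTemperedDistribution_injective hV]

theorem exists_rep_of_distLpNorm_lt_top {u : 𝓢'(Plane, ℂ)} (h : distLpNorm p u < ⊤) :
    ∃ U : Lp ℂ p (volume : Measure Plane), (U : 𝓢'(Plane, ℂ)) = u := by
  by_contra! hU
  simp [distLpNorm, hU] at h

theorem distLpNorm_zero : distLpNorm p 0 = 0 := by
  rw [← toTemperedDistribution_zero (p := p), distLpNorm_coe, enorm_zero]

theorem eq_zero_of_distLpNorm_eq_zero {u : 𝓢'(Plane, ℂ)} (h : distLpNorm p u = 0) : u = 0 := by
  obtain ⟨U, rfl⟩ := exists_rep_of_distLpNorm_lt_top (h.trans_lt ENNReal.zero_lt_top)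
  rw [distLpNorm_coe, enorm_eq_zero] at h
  rw [h, toTemperedDistribution_zero]

theorem distLpNorm_neg (u : 𝓢'(Plane, ℂ)) : distLpNorm p (-u) = distLpNorm p u := by
  have key : ∀ v : 𝓢'(Plane, ℂ), distLpNorm p (-v) ≤ distLpNorm p v := by
    intro v
    refine le_iInf₂ fun V hV => ?_
    rw [← hV, ← toTemperedDistribution_neg, distLpNorm_coe, enorm_neg]
  exact le_antisymm (key u) (by simpa using key (-u))

theorem distLpNorm_add_le (u v : 𝓢'(Plane, ℂ)) :
    distLpNorm p (u + v) ≤ distLpNorm p u + distLpNorm p v := by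
  by_cases hu : distLpNorm p u < ⊤
  · by_cases hv : distLpNorm p v < ⊤
    · obtain ⟨U, rfl⟩ := exists_rep_of_distLpNorm_lt_top hu
      obtain ⟨V, rfl⟩ := exists_rep_of_distLpNorm_lt_top hv
      rw [← toTemperedDistribution_add, distLpNorm_coe, distLpNorm_coe, distLpNorm_coe]
      exact enorm_add_le U V
    · rw [not_lt_top_iff.mp hv, add_top]; exact le_top
  · rw [not_lt_top_iff.mp hu, top_add]; exact le_top

/-- A series of distributions with summable `L^p` norms is represented by an `L^p`-convergent
series. -/
theorem exists_hasSum_rep_of_tsum_distLpNorm_lt_top {ι : Type*} {u : ι → 𝓢'(Plane, ℂ)}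
    (h : ∑' i, distLpNorm p (u i) < ⊤) :
    ∃ (U : ι → Lp ℂ p (volume : Measure Plane)) (V : Lp ℂ p (volume : Measure Plane)),
      (∀ i, (U i : 𝓢'(Plane, ℂ)) = u i) ∧ Summable (fun i => ‖U i‖) ∧ HasSum U V ∧
      ‖V‖ₑ ≤ ∑' i, distLpNorm p (u i) := by
  have hi : ∀ i, distLpNorm p (u i) < ⊤ := fun i => (ENNReal.le_tsum i).trans_lt h
  choose U hU using fun i => exists_rep_of_distLpNorm_lt_top (hi i)
  have hnorm : ∀ i, distLpNorm p (u i) = ‖U i‖ₑ := fun i => by rw [← hU i, distLpNorm_coe]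
  simp only [hnorm] at h ⊢
  have hs : Summable (fun i => ‖U i‖) := by
    have := ENNReal.summable_toReal h.ne
    simpa [toReal_enorm] using this
  refine ⟨U, ∑' i, U i, hU, hs, hs.of_norm.hasSum, enorm_tsum_le_tsum_enorm⟩

theorem summable_of_tsum_distLpNorm_lt_top {ι : Type*} {u : ι → 𝓢'(Plane, ℂ)}
    (h : ∑' i, distLpNorm p (u i) < ⊤) : Summable u := by
  obtain ⟨U, V, hU, -, hV, -⟩ := exists_hasSum_rep_of_tsum_distLpNorm_lt_top h
  have := hasSum_toTemperedDistribution hV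
  simp only [hU] at this
  exact this.summable

/-- When the right side is finite the series also converges in `L^p`, and its limit there must be
`v` since limits in `𝓢'` are unique. -/
theorem distLpNorm_le_tsum {ι : Type*} {u : ι → 𝓢'(Plane, ℂ)} {v : 𝓢'(Plane, ℂ)}
    (h : HasSum u v) : distLpNorm p v ≤ ∑' i, distLpNorm p (u i) := by
  by_cases ht : ∑' i, distLpNorm p (u i) < ⊤
  · obtain ⟨U, V, hU, -, hV, hle⟩ := exists_hasSum_rep_of_tsum_distLpNorm_lt_top ht
    have := hasSum_toTemperedDistribution hV
    simp only [hU] at this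
    rw [h.unique this, distLpNorm_coe]
    exact hle
  · rw [not_lt_top_iff.mp ht]; exact le_top

/-- Two functions of possibly different Lebesgue spaces that represent the same distribution agree
almost everywhere. -/
theorem ae_eq_of_toTemperedDistribution_eq {q : ℝ≥0∞} [Fact (1 ≤ q)]
    {U : Lp ℂ p (volume : Measure Plane)} {V : Lp ℂ q (volume : Measure Plane)}
    (h : (U : 𝓢'(Plane, ℂ)) = V) : U =ᵐ[volume] V := by
  refine ae_eq_of_integral_contDiff_smul_eq ((Lp.memLp U).locallyIntegrable Fact.out)
    ((Lp.memLp V).locallyIntegrable Fact.out) fun g hg hc => ?_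
  have hc' : HasCompactSupport (Complex.ofRealCLM ∘ g) := hc.comp_left rfl
  have hg' : ContDiff ℝ ∞ (Complex.ofRealCLM ∘ g) := by fun_prop
  have := DFunLike.congr_fun h (hc'.toSchwartzMap hg')
  simpa using this

end DistLpNorm

/-! ### Fourier multipliers with Schwartz symbols on Lebesgue spaces -/

section Convolution

open FourierTransform

/-- Jensen's inequality in unnormalized form: compare the `L^1` and `L^r` norms of `u` for the
measure with density `k`, whose total mass is `∫ k`. -/
theorem lintegral_mul_rpow_le {r : ℝ} (hr : 1 ≤ r) {k u : Plane → ℝ≥0∞} (hk : Measurable k)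
    (hu : Measurable u) :
    (∫⁻ x, k x * u x) ^ r ≤ (∫⁻ x, k x) ^ (r - 1) * ∫⁻ x, k x * u x ^ r := by
  have hr0 : 0 < r := by linarith
  have h := eLpNorm_le_eLpNorm_mul_rpow_measure_univ (μ := volume.withDensity k) (f := u)
    (p := 1) (q := ENNReal.ofReal r) (by simpa using hr) hu.aestronglyMeasurable
  rw [eLpNorm_one_eq_lintegral_enorm, eLpNorm_eq_lintegral_rpow_enorm_toReal (by simpa using hr0)
    ENNReal.ofReal_ne_top, ENNReal.toReal_ofReal hr0.le, withDensity_apply _ MeasurableSet.univ,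
    Measure.restrict_univ, lintegral_withDensity_eq_lintegral_mul _ hk (by fun_prop),
    lintegral_withDensity_eq_lintegral_mul _ hk (by fun_prop)] at h
  simp only [Pi.mul_apply, enorm_eq_self, ENNReal.toReal_one] at h
  calc (∫⁻ x, k x * u x) ^ r
      ≤ ((∫⁻ x, k x * u x ^ r) ^ (1 / r) * (∫⁻ x, k x) ^ (1 / 1 - 1 / r)) ^ r := by gcongr
    _ = (∫⁻ x, k x) ^ (r - 1) * ∫⁻ x, k x * u x ^ r := by
      rw [ENNReal.mul_rpow_of_nonneg _ _ hr0.le, ← ENNReal.rpow_mul, ← ENNReal.rpow_mul, mul_comm]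
      congr 2
      · field_simp
      · rw [one_div_mul_cancel hr0.ne', ENNReal.rpow_one]

theorem fourierMultiplierCLM_eq_integral (σ a : 𝓢(Plane, ℂ)) (x : Plane) :
    SchwartzMap.fourierMultiplierCLM ℂ σ a x = ∫ t, (𝓕⁻ σ) t * a (x - t) := by
  have h : SchwartzMap.fourierMultiplierCLM ℂ σ a =
      SchwartzMap.convolution (ContinuousLinearMap.mul ℂ ℂ) (𝓕⁻ σ) a := by
    rw [SchwartzMap.fourierMultiplierCLM_apply, SchwartzMap.convolution]
    simp only [LinearMap.coe_mk, AddHom.coe_mk, ContinuousLinearMap.comp_apply,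
      FourierTransform.fourier_fourierInv_eq, fourierInvCLM_apply, fourierCLM_apply]
    congr 1
    ext y
    rw [SchwartzMap.smulLeftCLM_apply_apply σ.hasTemperateGrowth]
    simp
  rw [h, SchwartzMap.convolution_apply]
  rfl

variable {p : ℝ≥0∞} [hp1 : Fact (1 ≤ p)]

/-- Common source of Young's and Bernstein's inequalities: integrating in `x` gives the `L^p` bound,
and replacing the kernel in the last integral by its supremum gives the `L^∞` bound. -/
theorem enorm_fourierMultiplierCLM_rpow_le (hp : p ≠ ⊤) (σ a : 𝓢(Plane, ℂ)) (x : Plane) :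
    ‖SchwartzMap.fourierMultiplierCLM ℂ σ a x‖ₑ ^ p.toReal ≤
      (∫⁻ t : Plane, ‖(𝓕⁻ σ) t‖ₑ) ^ (p.toReal - 1) *
        ∫⁻ t : Plane, ‖(𝓕⁻ σ) t‖ₑ * ‖a (x - t)‖ₑ ^ p.toReal := by
  have hr : 1 ≤ p.toReal := by
    rw [← ENNReal.toReal_one]; exact ENNReal.toReal_mono hp hp1.out
  have ha : Measurable a := a.continuous.measurable
  refine le_trans ?_ (lintegral_mul_rpow_le hr (𝓕⁻ σ).continuous.measurable.enorm
    (ha.comp (measurable_const.sub measurable_id)).enorm)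
  gcongr
  rw [fourierMultiplierCLM_eq_integral]
  refine (enorm_integral_le_lintegral_enorm _).trans (le_of_eq ?_)
  simp [enorm_mul]

theorem eLpNorm_fourierMultiplierCLM_le (hp : p ≠ ⊤) (σ a : 𝓢(Plane, ℂ)) :
    eLpNorm (SchwartzMap.fourierMultiplierCLM ℂ σ a) p volume ≤
      (∫⁻ t : Plane, ‖(𝓕⁻ σ) t‖ₑ) * eLpNorm a p volume := by
  have hp0 : p ≠ 0 := (zero_lt_one.trans_le hp1.out).ne'
  have hr : 1 ≤ p.toReal := by
    rw [← ENNReal.toReal_one]; exact ENNReal.toReal_mono hp hp1.out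
  have hr0 : 0 < p.toReal := by linarith
  have ha : Measurable a := a.continuous.measurable
  have hK : Measurable (⇑(𝓕⁻ σ : 𝓢(Plane, ℂ))) := (𝓕⁻ σ).continuous.measurable
  rw [eLpNorm_eq_lintegral_rpow_enorm_toReal hp0 hp, eLpNorm_eq_lintegral_rpow_enorm_toReal hp0 hp,
    ← ENNReal.rpow_le_rpow_iff hr0, ENNReal.mul_rpow_of_nonneg _ _ hr0.le, ← ENNReal.rpow_mul,
    ← ENNReal.rpow_mul, one_div_mul_cancel hr0.ne', ENNReal.rpow_one, ENNReal.rpow_one]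
  have hm : Measurable fun z : Plane × Plane => ‖(𝓕⁻ σ) z.2‖ₑ * ‖a (z.1 - z.2)‖ₑ ^ p.toReal :=
    (hK.comp measurable_snd).enorm.mul
      ((ha.comp (measurable_fst.sub measurable_snd)).enorm.pow_const _)
  refine (lintegral_mono fun x => enorm_fourierMultiplierCLM_rpow_le hp σ a x).trans (le_of_eq ?_)
  have hswap : ∫⁻ x, ∫⁻ t : Plane, ‖(𝓕⁻ σ) t‖ₑ * ‖a (x - t)‖ₑ ^ p.toReal =
      (∫⁻ t : Plane, ‖(𝓕⁻ σ) t‖ₑ) * ∫⁻ x, ‖a x‖ₑ ^ p.toReal := by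
    rw [lintegral_lintegral_swap hm.aemeasurable, ← lintegral_mul_const _ hK.enorm]
    congr 1 with t
    rw [lintegral_const_mul _ (by fun_prop)]
    congr 1
    exact lintegral_sub_right_eq_self (fun x => ‖a x‖ₑ ^ p.toReal) t
  rw [lintegral_const_mul _ hm.lintegral_prod_right', hswap, ← mul_assoc]
  congr 1
  nth_rw 2 [← ENNReal.rpow_one (lintegral _ _)]
  rw [← ENNReal.rpow_add_of_nonneg _ _ (by linarith) zero_le_one, sub_add_cancel]

/-- The kernel factor dominates the `L^{p'}` norm of the kernel. In this form it is easy to rescale,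
because only the `L^1` norm and the supremum enter. -/
theorem eLpNorm_top_fourierMultiplierCLM_le (hp : p ≠ ⊤) (σ a : 𝓢(Plane, ℂ)) {S : ℝ≥0∞}
    (hS : ∀ t, ‖(𝓕⁻ σ) t‖ₑ ≤ S) :
    eLpNorm (SchwartzMap.fourierMultiplierCLM ℂ σ a) ⊤ volume ≤
      (∫⁻ t : Plane, ‖(𝓕⁻ σ) t‖ₑ) ^ (1 - 1 / p.toReal) * S ^ (1 / p.toReal) * eLpNorm a p volume := by
  have hp0 : p ≠ 0 := (zero_lt_one.trans_le hp1.out).ne'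
  have hr : 1 ≤ p.toReal := by
    rw [← ENNReal.toReal_one]; exact ENNReal.toReal_mono hp hp1.out
  have hr0 : 0 < p.toReal := by linarith
  rw [eLpNorm_exponent_top]
  refine eLpNormEssSup_le_of_ae_enorm_bound (Filter.Eventually.of_forall fun x => ?_)
  rw [eLpNorm_eq_lintegral_rpow_enorm_toReal hp0 hp, ← ENNReal.rpow_le_rpow_iff hr0,
    ENNReal.mul_rpow_of_nonneg _ _ hr0.le, ENNReal.mul_rpow_of_nonneg _ _ hr0.le,
    ← ENNReal.rpow_mul, ← ENNReal.rpow_mul, ← ENNReal.rpow_mul, one_div_mul_cancel hr0.ne',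
    ENNReal.rpow_one, ENNReal.rpow_one, sub_mul, one_div_mul_cancel hr0.ne', one_mul, mul_assoc]
  refine (enorm_fourierMultiplierCLM_rpow_le hp σ a x).trans ?_
  gcongr
  calc ∫⁻ t : Plane, ‖(𝓕⁻ σ) t‖ₑ * ‖a (x - t)‖ₑ ^ p.toReal
      ≤ ∫⁻ t : Plane, S * ‖a (x - t)‖ₑ ^ p.toReal := lintegral_mono fun t => by gcongr; exact hS t
    _ = S * ∫⁻ t : Plane, ‖a t‖ₑ ^ p.toReal := by
      have ha : Measurable a := a.continuous.measurable
      have hx : Measurable fun t => ‖a (x - t)‖ₑ ^ p.toReal :=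
        (ha.comp (measurable_const.sub measurable_id)).enorm.pow_const _
      rw [lintegral_const_mul _ hx]
      congr 1
      exact lintegral_sub_left_eq_self (fun x => ‖a x‖ₑ ^ p.toReal) x

theorem denseRange_toLpCLM_complex (hp : p ≠ ⊤) :
    DenseRange (SchwartzMap.toLpCLM ℂ ℂ p (volume : Measure Plane)) :=
  SchwartzMap.denseRange_toLpCLM (F := ℂ) (μ := (volume : Measure Plane)) hp

theorem enorm_toLp (a : 𝓢(Plane, ℂ)) (q : ℝ≥0∞) :
    ‖a.toLp q (volume : Measure Plane)‖ₑ = eLpNorm a q volume := by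
  rw [Lp.enorm_def, eLpNorm_congr_ae (a.coeFn_toLp q volume)]

/-- A Fourier multiplier that is bounded from `L^p` to `L^q` on Schwartz functions extends to a
bounded operator from `L^p` to `L^q`. -/
theorem exists_clm_of_eLpNorm_le (hp : p ≠ ⊤) {q : ℝ≥0∞} [Fact (1 ≤ q)] (σ : 𝓢(Plane, ℂ))
    {C : ℝ≥0} (h : ∀ a : 𝓢(Plane, ℂ),
      eLpNorm (SchwartzMap.fourierMultiplierCLM ℂ σ a) q volume ≤ C * eLpNorm a p volume) :
    ∃ T : Lp ℂ p (volume : Measure Plane) →L[ℂ] Lp ℂ q (volume : Measure Plane),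
      (∀ U, (T U : 𝓢'(Plane, ℂ)) =
        TemperedDistribution.fourierMultiplierCLM ℂ σ (U : 𝓢'(Plane, ℂ))) ∧
      ∀ U, ‖T U‖ₑ ≤ C * ‖U‖ₑ := by
  let f : 𝓢(Plane, ℂ) →ₗ[ℂ] Lp ℂ q (volume : Measure Plane) :=
    (SchwartzMap.toLpCLM ℂ ℂ q (volume : Measure Plane) ∘L
      SchwartzMap.fourierMultiplierCLM ℂ σ).toLinearMap
  let e : 𝓢(Plane, ℂ) →ₗ[ℂ] Lp ℂ p (volume : Measure Plane) :=
    (SchwartzMap.toLpCLM ℂ ℂ p (volume : Measure Plane)).toLinearMap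
  have he : DenseRange e := denseRange_toLpCLM_complex hp
  have hb : ∀ a, ‖f a‖ ≤ C * ‖e a‖ := by
    intro a
    have := h a
    rw [← enorm_toLp, ← enorm_toLp] at this
    have h2 := ENNReal.toReal_mono (by finiteness) this
    simpa [f, e, toReal_enorm] using h2
  have hT : ∀ a, f.extendOfNorm e (e a) = f a := LinearMap.extendOfNorm_eq he ⟨C, hb⟩
  refine ⟨f.extendOfNorm e, ?_, fun U => ?_⟩
  · intro U
    have hcont : (fun U => Lp.toTemperedDistributionCLM ℂ (volume : Measure Plane) q
        (f.extendOfNorm e U)) = fun U => TemperedDistribution.fourierMultiplierCLM ℂ σ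
          (Lp.toTemperedDistributionCLM ℂ (volume : Measure Plane) p U) := by
      -- Both sides are continuous in `U` with values in `𝓢'` and agree on Schwartz functions, which
      -- are dense because `p < ∞`.
      refine he.equalizer (by fun_prop) (by fun_prop) ?_
      funext a
      simp only [Function.comp_apply, hT]
      simp only [f, e, ContinuousLinearMap.coe_coe, ContinuousLinearMap.comp_apply,
        SchwartzMap.toLpCLM_apply, Lp.toTemperedDistributionCLM_apply,
        Lp.toTemperedDistribution_toLp_eq]
      rw [TemperedDistribution.fourierMultiplierCLM_toTemperedDistributionCLM_eq
        σ.hasTemperateGrowth]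
    exact congrFun hcont U
  · have := LinearMap.norm_extendOfNorm_apply_le he C hb U
    rw [← ofReal_norm, ← ofReal_norm]
    refine (ENNReal.ofReal_le_ofReal this).trans ?_
    rw [ENNReal.ofReal_mul C.coe_nonneg, ENNReal.ofReal_coe_nnreal]

end Convolution

/-! ### Dyadic dilations of a symbol -/

/-- The weight `2^{sj}`. -/
noncomputable def dyadicWeight (s : ℝ) (j : ℤ) : ℝ≥0∞ := ENNReal.ofReal ((2 : ℝ) ^ (s * (j : ℝ)))

theorem dyadicWeight_ne_top (s : ℝ) (j : ℤ) : dyadicWeight s j ≠ ⊤ := ENNReal.ofReal_ne_top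

theorem dyadicWeight_ne_zero (s : ℝ) (j : ℤ) : dyadicWeight s j ≠ 0 := by
  rw [dyadicWeight, Ne, ENNReal.ofReal_eq_zero, not_le]
  positivity

theorem dyadicWeight_add_left (s t : ℝ) (j : ℤ) :
    dyadicWeight (s + t) j = dyadicWeight s j * dyadicWeight t j := by
  rw [dyadicWeight, dyadicWeight, dyadicWeight, ← ENNReal.ofReal_mul (by positivity),
    ← Real.rpow_add two_pos, add_mul]

theorem dyadicWeight_add_right (s : ℝ) (j k : ℤ) :
    dyadicWeight s (j + k) = dyadicWeight s j * dyadicWeight s k := by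
  rw [dyadicWeight, dyadicWeight, dyadicWeight, ← ENNReal.ofReal_mul (by positivity),
    ← Real.rpow_add two_pos, Int.cast_add, mul_add]

theorem dyadicWeight_rpow (s : ℝ) {t : ℝ} (ht : 0 ≤ t) (j : ℤ) :
    dyadicWeight s j ^ t = dyadicWeight (s * t) j := by
  rw [dyadicWeight, dyadicWeight, ENNReal.ofReal_rpow_of_nonneg (by positivity) ht,
    ← Real.rpow_mul two_pos.le]
  congr 2
  ring

theorem dyadicWeight_two (j : ℤ) : dyadicWeight 2 j = ENNReal.ofReal (((2 : ℝ) ^ j) ^ 2) := by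
  rw [dyadicWeight, mul_comm, Real.rpow_mul two_pos.le, Real.rpow_intCast]
  norm_num

section Dilation

open FourierTransform

theorem fourierInv_dilation {σ τ : 𝓢(Plane, ℂ)} {j : ℤ}
    (h : ∀ ξ, τ ξ = σ ((2 : ℝ) ^ (-j) • ξ)) (x : Plane) :
    (𝓕⁻ τ) x = (((2 : ℝ) ^ j) ^ 2 : ℝ) • (𝓕⁻ σ) ((2 : ℝ) ^ j • x) := by
  have hj : (0 : ℝ) < (2 : ℝ) ^ j := by positivity
  rw [SchwartzMap.fourierInv_coe, SchwartzMap.fourierInv_coe, Real.fourierInv_eq',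
    Real.fourierInv_eq']
  have := Measure.integral_comp_smul (volume : Measure Plane) (fun v : Plane =>
    Complex.exp (↑(2 * Real.pi * inner ℝ v ((2 : ℝ) ^ j • x)) * Complex.I) • σ v) ((2 : ℝ) ^ (-j))
  have hd : |(((2 : ℝ) ^ (-j)) ^ Module.finrank ℝ Plane)⁻¹| = ((2 : ℝ) ^ j) ^ 2 := by
    rw [finrank_euclideanSpace_fin, zpow_neg, inv_pow, inv_inv, abs_of_pos (by positivity)]
  rw [hd] at this
  rw [← this]
  congr 1 with v
  rw [h, inner_smul_left, inner_smul_right, zpow_neg]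
  congr 5
  simp only [conj_trivial]
  field_simp

theorem lintegral_fourierInv_dilation {σ τ : 𝓢(Plane, ℂ)} {j : ℤ}
    (h : ∀ ξ, τ ξ = σ ((2 : ℝ) ^ (-j) • ξ)) :
    ∫⁻ x : Plane, ‖(𝓕⁻ τ) x‖ₑ = ∫⁻ x : Plane, ‖(𝓕⁻ σ) x‖ₑ := by
  have hj : (0 : ℝ) < (2 : ℝ) ^ j := by positivity
  rw [← ofReal_integral_norm_eq_lintegral_enorm (𝓕⁻ τ).integrable,
    ← ofReal_integral_norm_eq_lintegral_enorm (𝓕⁻ σ).integrable]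
  congr 1
  have := Measure.integral_comp_smul (volume : Measure Plane)
    (fun v : Plane => ‖(𝓕⁻ σ) v‖) ((2 : ℝ) ^ j)
  simp only [fourierInv_dilation h, norm_smul, Real.norm_eq_abs, abs_of_pos (pow_pos hj 2)]
  rw [integral_const_mul, this, finrank_euclideanSpace_fin, abs_of_pos (by positivity), smul_eq_mul,
    mul_inv_cancel_left₀ (by positivity)]

variable {p : ℝ≥0∞} [hp1 : Fact (1 ≤ p)]

/-- Young's and Bernstein's inequalities for the dyadic dilates of a Schwartz symbol. -/
theorem exists_clm_dilation (hp : p ≠ ⊤) (σ : 𝓢(Plane, ℂ)) :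
    ∃ C : ℝ≥0, 1 ≤ C ∧ ∀ (j : ℤ) (τ : 𝓢(Plane, ℂ)), (∀ ξ, τ ξ = σ ((2 : ℝ) ^ (-j) • ξ)) →
      (∃ T : Lp ℂ p (volume : Measure Plane) →L[ℂ] Lp ℂ p (volume : Measure Plane),
        (∀ U, (T U : 𝓢'(Plane, ℂ)) =
          TemperedDistribution.fourierMultiplierCLM ℂ τ (U : 𝓢'(Plane, ℂ))) ∧
        ∀ U, ‖T U‖ₑ ≤ C * ‖U‖ₑ) ∧
      ∃ T : Lp ℂ p (volume : Measure Plane) →L[ℂ] Lp ℂ ⊤ (volume : Measure Plane),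
        (∀ U, (T U : 𝓢'(Plane, ℂ)) =
          TemperedDistribution.fourierMultiplierCLM ℂ τ (U : 𝓢'(Plane, ℂ))) ∧
        ∀ U, ‖T U‖ₑ ≤ C * dyadicWeight (2 / p.toReal) j * ‖U‖ₑ := by
  have hr : 1 ≤ p.toReal := by
    rw [← ENNReal.toReal_one]; exact ENNReal.toReal_mono hp hp1.out
  have hr0 : 0 < p.toReal := by linarith
  have hk : ∫⁻ x : Plane, ‖(𝓕⁻ σ) x‖ₑ < ⊤ := (𝓕⁻ σ).integrable.hasFiniteIntegral
  obtain ⟨k, hk'⟩ : ∃ k : ℝ≥0, (k : ℝ≥0∞) = ∫⁻ x : Plane, ‖(𝓕⁻ σ) x‖ₑ :=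
    ⟨_, ENNReal.coe_toNNReal hk.ne⟩
  obtain ⟨S, hS⟩ : ∃ S : ℝ≥0, ∀ x, ‖(𝓕⁻ σ) x‖ₑ ≤ S := by
    refine ⟨(SchwartzMap.seminorm ℝ 0 0 (𝓕⁻ σ)).toNNReal, fun x => ?_⟩
    rw [← ofReal_norm]
    exact ENNReal.ofReal_le_ofReal (SchwartzMap.norm_le_seminorm ℝ _ x)
  have he : 0 ≤ 1 - 1 / p.toReal := by
    rw [sub_nonneg, div_le_one hr0]; exact hr
  have he' : 0 ≤ 1 / p.toReal := by positivity
  -- The summand `1` keeps the constant away from zero, so that later bounds stay valid when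
  -- `distLpNorm` is infinite: `C * ⊤ = ⊤`.
  refine ⟨1 + k + k ^ (1 - 1 / p.toReal) * S ^ (1 / p.toReal), ?_, fun j τ h => ⟨?_, ?_⟩⟩
  · rw [add_assoc]; exact le_self_add
  · obtain ⟨T, hT, hT'⟩ := exists_clm_of_eLpNorm_le (q := p) (C := k) hp τ (fun a => by
      rw [hk', ← lintegral_fourierInv_dilation h]
      exact eLpNorm_fourierMultiplierCLM_le hp τ a)
    refine ⟨T, hT, fun U => (hT' U).trans ?_⟩
    gcongr
    rw [add_comm 1, add_assoc]; exact le_self_add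
  -- The dilated kernel `2^{2j} K(2^j ·)` keeps its `L^1` norm, while its supremum gains `2^{2j}`;
  -- the power `1/p` of that gain is the weight `2^{2j/p}`.
  · have hw : dyadicWeight (2 / p.toReal) j = dyadicWeight 2 j ^ (1 / p.toReal) := by
      rw [dyadicWeight_rpow _ he', mul_one_div]
    obtain ⟨T, hT, hT'⟩ := exists_clm_of_eLpNorm_le (q := ⊤) hp τ
        (C := k ^ (1 - 1 / p.toReal) * S ^ (1 / p.toReal) *
          (dyadicWeight (2 / p.toReal) j).toNNReal) (fun a => by
      have := eLpNorm_top_fourierMultiplierCLM_le hp τ a (S := dyadicWeight 2 j * S) (fun t => by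
        rw [fourierInv_dilation h, enorm_smul, dyadicWeight_two,
          Real.enorm_eq_ofReal (by positivity)]
        gcongr
        exact hS _)
      rw [lintegral_fourierInv_dilation h, ← hk', ENNReal.mul_rpow_of_nonneg _ _ he', ← hw] at this
      refine this.trans (le_of_eq ?_)
      push_cast
      rw [ENNReal.coe_toNNReal (dyadicWeight_ne_top _ _), ENNReal.coe_rpow_of_nonneg _ he,
        ENNReal.coe_rpow_of_nonneg _ he']
      ring)
    refine ⟨T, hT, fun U => (hT' U).trans ?_⟩
    rw [ENNReal.coe_mul, ENNReal.coe_toNNReal (dyadicWeight_ne_top _ _)]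
    gcongr
    exact le_add_self

end Dilation

/-! ### Products of band-limited functions -/

section Product

open FourierTransform

/-- Multiplication by a bounded function on `L^q`. -/
noncomputable def lpMul (q : ℝ≥0∞) [Fact (1 ≤ q)] :
    Lp ℂ ⊤ (volume : Measure Plane) →L[ℂ] Lp ℂ q (volume : Measure Plane) →L[ℂ]
      Lp ℂ q (volume : Measure Plane) :=
  (ContinuousLinearMap.mul ℂ ℂ).holderL volume ⊤ q q

variable {q : ℝ≥0∞} [Fact (1 ≤ q)]

theorem coeFn_lpMul (F : Lp ℂ ⊤ (volume : Measure Plane)) (G : Lp ℂ q (volume : Measure Plane)) :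
    lpMul q F G =ᵐ[volume] fun x => F x * G x :=
  (ContinuousLinearMap.mul ℂ ℂ).coeFn_holder F G

theorem norm_lpMul_le (F : Lp ℂ ⊤ (volume : Measure Plane))
    (G : Lp ℂ q (volume : Measure Plane)) : ‖lpMul q F G‖ ≤ ‖F‖ * ‖G‖ := by
  have h := (ContinuousLinearMap.mul ℂ ℂ).norm_holder_apply_apply_le (r := q) F G
  refine h.trans ?_
  gcongr
  exact mul_le_of_le_one_left (norm_nonneg _) (ContinuousLinearMap.opNorm_mul_le ℂ ℂ)

theorem enorm_lpMul_le (F : Lp ℂ ⊤ (volume : Measure Plane))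
    (G : Lp ℂ q (volume : Measure Plane)) : ‖lpMul q F G‖ₑ ≤ ‖F‖ₑ * ‖G‖ₑ := by
  rw [← ofReal_norm, ← ofReal_norm, ← ofReal_norm, ← ENNReal.ofReal_mul (norm_nonneg _)]
  exact ENNReal.ofReal_le_ofReal (norm_lpMul_le F G)

/-- The convolution theorem, passed from `𝓕⁻` to `𝓕` by the reflection `𝓕 u (ζ) = 𝓕⁻ u (-ζ)`; this
accounts for the signs. -/
theorem fourier_pairing_eq_integral (s t : 𝓢(Plane, ℂ)) (ξ : Plane) :
    𝓕 (SchwartzMap.pairing (ContinuousLinearMap.mul ℂ ℂ) s t) ξ =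
      ∫ ζ, (𝓕 s) (-ζ) * (𝓕 t) (ξ + ζ) := by
  have h : 𝓕⁻ (SchwartzMap.pairing (ContinuousLinearMap.mul ℂ ℂ) s t) =
      SchwartzMap.convolution (ContinuousLinearMap.mul ℂ ℂ) (𝓕⁻ s) (𝓕⁻ t) := by
    simp [SchwartzMap.convolution]
  have hneg : ∀ (u : 𝓢(Plane, ℂ)) (ζ : Plane), (𝓕 u) ζ = (𝓕⁻ u) (-ζ) := fun u ζ => by
    rw [SchwartzMap.fourierInv_coe, Real.fourierInv_eq_fourier_neg, neg_neg,
      SchwartzMap.fourier_coe]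
  rw [hneg, h, SchwartzMap.convolution_apply]
  simp only [hneg, neg_neg, neg_add]
  rfl

/-- The frequencies of a product of two functions whose frequencies lie in the balls of radius `R₁`
and `R₂` lie in the ball of radius `R₁ + R₂`. -/
theorem SchwartzMap.fourierMultiplierCLM_pairing_eq_zero {σ₁ σ₂ : 𝓢(Plane, ℂ)} {R₁ R₂ : ℝ}
    (h₁ : ∀ ξ, R₁ < ‖ξ‖ → σ₁ ξ = 0) (h₂ : ∀ ξ, R₂ < ‖ξ‖ → σ₂ ξ = 0) {m : Plane → ℂ}
    (hm : m.HasTemperateGrowth) (hm0 : ∀ ξ, ‖ξ‖ ≤ R₁ + R₂ → m ξ = 0) (a b : 𝓢(Plane, ℂ)) :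
    SchwartzMap.fourierMultiplierCLM ℂ m (SchwartzMap.pairing (ContinuousLinearMap.mul ℂ ℂ)
      (SchwartzMap.fourierMultiplierCLM ℂ σ₁ a) (SchwartzMap.fourierMultiplierCLM ℂ σ₂ b)) = 0 := by
  have hF : ∀ (σ c : 𝓢(Plane, ℂ)) (ξ : Plane), (𝓕 (SchwartzMap.fourierMultiplierCLM ℂ σ c)) ξ =
      σ ξ * (𝓕 c) ξ := fun σ c ξ => by
    rw [SchwartzMap.fourierMultiplierCLM_apply, FourierTransform.fourier_fourierInv_eq,
      SchwartzMap.smulLeftCLM_apply_apply σ.hasTemperateGrowth, smul_eq_mul]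
  rw [SchwartzMap.fourierMultiplierCLM_apply]
  refine (congrArg (fourierInvCLM ℂ 𝓢(Plane, ℂ)) ?_).trans
    (map_zero (fourierInvCLM ℂ 𝓢(Plane, ℂ)))
  ext ξ
  rw [SchwartzMap.smulLeftCLM_apply_apply hm, smul_eq_mul, zero_apply]
  by_cases hξ : ‖ξ‖ ≤ R₁ + R₂
  · rw [hm0 ξ hξ, zero_mul]
  · rw [fourier_pairing_eq_integral]
    simp only [hF]
    convert mul_zero _
    refine integral_eq_zero_of_ae (Filter.Eventually.of_forall fun ζ => ?_)
    by_cases hζ : R₁ < ‖-ζ‖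
    · simp [h₁ _ hζ]
    · have : R₂ < ‖ξ + ζ‖ := by
        have h3 : ‖ξ‖ ≤ ‖ξ + ζ‖ + ‖-ζ‖ := by simpa using norm_add_le (ξ + ζ) (-ζ)
        linarith
      simp [h₂ _ this]

variable {p : ℝ≥0∞} [hp1 : Fact (1 ≤ p)]

/-- Density carries the Schwartz case over to `L^p`: the expression is jointly continuous in `(U,
V)`. One factor is measured in `L^∞` so that the product remains in `L^p`. -/
theorem fourierMultiplierCLM_lpMul_eq_zero (hp : p ≠ ⊤) {σ₁ σ₂ : 𝓢(Plane, ℂ)} {R₁ R₂ : ℝ}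
    (h₁ : ∀ ξ, R₁ < ‖ξ‖ → σ₁ ξ = 0) (h₂ : ∀ ξ, R₂ < ‖ξ‖ → σ₂ ξ = 0) {m : Plane → ℂ}
    (hm : m.HasTemperateGrowth) (hm0 : ∀ ξ, ‖ξ‖ ≤ R₁ + R₂ → m ξ = 0)
    {T₁ : Lp ℂ p (volume : Measure Plane) →L[ℂ] Lp ℂ ⊤ (volume : Measure Plane)}
    (hT₁ : ∀ U, (T₁ U : 𝓢'(Plane, ℂ)) =
        TemperedDistribution.fourierMultiplierCLM ℂ σ₁ (U : 𝓢'(Plane, ℂ)))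
    {T₂ : Lp ℂ p (volume : Measure Plane) →L[ℂ] Lp ℂ p (volume : Measure Plane)}
    (hT₂ : ∀ U, (T₂ U : 𝓢'(Plane, ℂ)) =
        TemperedDistribution.fourierMultiplierCLM ℂ σ₂ (U : 𝓢'(Plane, ℂ)))
    (U V : Lp ℂ p (volume : Measure Plane)) :
    TemperedDistribution.fourierMultiplierCLM ℂ m (lpMul p (T₁ U) (T₂ V) : 𝓢'(Plane, ℂ)) = 0 := by
  have hd := denseRange_toLpCLM_complex hp
  have hcont : (fun z : Lp ℂ p (volume : Measure Plane) × Lp ℂ p (volume : Measure Plane) =>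
      TemperedDistribution.fourierMultiplierCLM ℂ m
        (Lp.toTemperedDistributionCLM ℂ (volume : Measure Plane) p
          (lpMul p (T₁ z.1) (T₂ z.2)))) = fun _ => 0 := by
    refine (hd.prodMap hd).equalizer (by fun_prop) (by fun_prop) ?_
    funext z
    obtain ⟨a, b⟩ := z
    simp only [Function.comp_apply, Prod.map_apply, SchwartzMap.toLpCLM_apply]
    have e₁ : T₁ (a.toLp p volume) =
        (SchwartzMap.fourierMultiplierCLM ℂ σ₁ a).toLp ⊤ volume := by
      apply toTemperedDistribution_injective
      rw [hT₁, Lp.toTemperedDistribution_toLp_eq, Lp.toTemperedDistribution_toLp_eq,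
        TemperedDistribution.fourierMultiplierCLM_toTemperedDistributionCLM_eq
          σ₁.hasTemperateGrowth]
    have e₂ : T₂ (b.toLp p volume) =
        (SchwartzMap.fourierMultiplierCLM ℂ σ₂ b).toLp p volume := by
      apply toTemperedDistribution_injective
      rw [hT₂, Lp.toTemperedDistribution_toLp_eq, Lp.toTemperedDistribution_toLp_eq,
        TemperedDistribution.fourierMultiplierCLM_toTemperedDistributionCLM_eq
          σ₂.hasTemperateGrowth]
    have e₃ : lpMul p ((SchwartzMap.fourierMultiplierCLM ℂ σ₁ a).toLp ⊤ volume)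
        ((SchwartzMap.fourierMultiplierCLM ℂ σ₂ b).toLp p volume) =
        (SchwartzMap.pairing (ContinuousLinearMap.mul ℂ ℂ)
          (SchwartzMap.fourierMultiplierCLM ℂ σ₁ a)
          (SchwartzMap.fourierMultiplierCLM ℂ σ₂ b)).toLp p volume := by
      apply Lp.ext
      filter_upwards [coeFn_lpMul ((SchwartzMap.fourierMultiplierCLM ℂ σ₁ a).toLp ⊤ volume)
        ((SchwartzMap.fourierMultiplierCLM ℂ σ₂ b).toLp p volume),
        (SchwartzMap.fourierMultiplierCLM ℂ σ₁ a).coeFn_toLp ⊤ volume,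
        (SchwartzMap.fourierMultiplierCLM ℂ σ₂ b).coeFn_toLp p volume,
        (SchwartzMap.pairing (ContinuousLinearMap.mul ℂ ℂ)
          (SchwartzMap.fourierMultiplierCLM ℂ σ₁ a)
          (SchwartzMap.fourierMultiplierCLM ℂ σ₂ b)).coeFn_toLp p volume] with x k₁ k₂ k₃ k₄
      rw [k₁, k₂, k₃, k₄]
      rfl
    rw [e₁, e₂, e₃, Lp.toTemperedDistributionCLM_apply, Lp.toTemperedDistribution_toLp_eq,
      TemperedDistribution.fourierMultiplierCLM_toTemperedDistributionCLM_eq hm,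
      SchwartzMap.fourierMultiplierCLM_pairing_eq_zero h₁ h₂ hm hm0, map_zero]
  exact congrFun hcont (U, V)

end Product

/-! ### The symbols of the Littlewood--Paley decomposition -/

/-- The dyadic dilate `σ(2^{-j} ·)` of a Schwartz function. -/
noncomputable def dyadicDilate (σ : 𝓢(Plane, ℂ)) (j : ℤ) : 𝓢(Plane, ℂ) :=
  SchwartzMap.compCLMOfContinuousLinearEquiv ℂ
    (ContinuousLinearEquiv.smulLeft (R₁ := ℝ) (M₁ := Plane)
      (Units.mk0 ((2 : ℝ) ^ (-j)) (by positivity))) σ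

theorem dyadicDilate_apply (σ : 𝓢(Plane, ℂ)) (j : ℤ) (ξ : Plane) :
    dyadicDilate σ j ξ = σ ((2 : ℝ) ^ (-j) • ξ) := rfl

/-! ### Algebra of Fourier multipliers on distributions -/

section Multipliers

variable {m m₁ m₂ : Plane → ℂ}

theorem fourierMultiplierCLM_sub_apply (h₁ : m₁.HasTemperateGrowth) (h₂ : m₂.HasTemperateGrowth)
    (u : 𝓢'(Plane, ℂ)) :
    TemperedDistribution.fourierMultiplierCLM ℂ (m₁ - m₂) u =
      TemperedDistribution.fourierMultiplierCLM ℂ m₁ u -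
        TemperedDistribution.fourierMultiplierCLM ℂ m₂ u := by
  simp only [TemperedDistribution.fourierMultiplierCLM_apply,
    TemperedDistribution.smulLeftCLM_sub h₁ h₂, sub_apply]
  exact map_sub (FourierTransform.fourierInvCLM ℂ 𝓢'(Plane, ℂ)) _ _

theorem fourierMultiplierCLM_comp_eq (h₁ : m₁.HasTemperateGrowth) (h₂ : m₂.HasTemperateGrowth)
    (h : ∀ ξ, m ξ = m₁ ξ * m₂ ξ) (u : 𝓢'(Plane, ℂ)) :
    TemperedDistribution.fourierMultiplierCLM ℂ m₁
      (TemperedDistribution.fourierMultiplierCLM ℂ m₂ u) =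
      TemperedDistribution.fourierMultiplierCLM ℂ m u := by
  rw [TemperedDistribution.fourierMultiplierCLM_fourierMultiplierCLM_apply h₂ h₁]
  congr 2
  funext ξ
  rw [h, Pi.mul_apply, mul_comm]

end Multipliers

/-! ### Young and Bernstein bounds for distributions -/

section DistLpNormBounds

variable {p : ℝ≥0∞} [hp1 : Fact (1 ≤ p)]

theorem distLpNorm_smul_le (c : ℂ) (u : 𝓢'(Plane, ℂ)) (hc : c ≠ 0) :
    distLpNorm p (c • u) ≤ ‖c‖ₑ * distLpNorm p u := by
  by_cases hu : distLpNorm p u < ⊤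
  · obtain ⟨U, rfl⟩ := exists_rep_of_distLpNorm_lt_top hu
    have : c • (U : 𝓢'(Plane, ℂ)) = ((c • U : Lp ℂ p (volume : Measure Plane)) : 𝓢'(Plane, ℂ)) :=
      (map_smul (Lp.toTemperedDistributionCLM ℂ (volume : Measure Plane) p) c U).symm
    rw [this, distLpNorm_coe, distLpNorm_coe, enorm_smul]
  · rw [not_lt_top_iff.mp hu, ENNReal.mul_top (by simpa using hc)]
    exact le_top

theorem exists_distLpNorm_dyadicDilate_le (hp : p ≠ ⊤) (σ : 𝓢(Plane, ℂ)) :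
    ∃ C : ℝ≥0, 1 ≤ C ∧ ∀ (j : ℤ) (u : 𝓢'(Plane, ℂ)),
      distLpNorm p (TemperedDistribution.fourierMultiplierCLM ℂ (dyadicDilate σ j) u) ≤
        C * distLpNorm p u ∧
      distLpNorm ⊤ (TemperedDistribution.fourierMultiplierCLM ℂ (dyadicDilate σ j) u) ≤
        C * dyadicWeight (2 / p.toReal) j * distLpNorm p u := by
  obtain ⟨C, hC1, hC⟩ := exists_clm_dilation hp σ
  have hC0 : (C : ℝ≥0∞) ≠ 0 := by
    rw [ENNReal.coe_ne_zero]; exact (zero_lt_one.trans_le hC1).ne'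
  refine ⟨C, hC1, fun j u => ?_⟩
  by_cases hu : distLpNorm p u < ⊤
  · obtain ⟨U, rfl⟩ := exists_rep_of_distLpNorm_lt_top hu
    obtain ⟨⟨T, hT, hT'⟩, S, hS, hS'⟩ := hC j _ (dyadicDilate_apply σ j)
    rw [distLpNorm_coe, ← hT, distLpNorm_coe]
    refine ⟨hT' U, ?_⟩
    rw [hT, ← hS, distLpNorm_coe]
    exact hS' U
  · rw [not_lt_top_iff.mp hu, ENNReal.mul_top hC0,
      ENNReal.mul_top (mul_ne_zero hC0 (dyadicWeight_ne_zero _ _))]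
    exact ⟨le_top, le_top⟩

end DistLpNormBounds

namespace LittlewoodPaley

variable (φ : LittlewoodPaley)

theorem contDiff_symbol (j : ℤ) : ContDiff ℝ ∞ (φ.symbol j) :=
  Complex.ofRealCLM.contDiff.comp
    (φ.smooth.comp (contDiff_const_smul (𝕜 := ℝ) (n := ∞) (F := Plane) ((2 : ℝ) ^ (-j))))

theorem symbol_smul (j k : ℤ) (ξ : Plane) :
    φ.symbol j ((2 : ℝ) ^ k • ξ) = φ.symbol (j - k) ξ := by
  rw [symbol, symbol, smul_smul, ← zpow_add₀ two_ne_zero]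
  congr 3
  ring_nf

theorem sum_symbol_eq_one {ξ : Plane} (hξ : ξ ≠ 0) {s : Finset ℤ}
    (hs : ∀ j ∉ s, ‖ξ‖ < (2 : ℝ) ^ j / 2 ∨ (2 : ℝ) ^ j * 2 < ‖ξ‖) :
    ∑ j ∈ s, φ.symbol j ξ = 1 := by
  have h : HasSum (fun j => φ.symbol j ξ) 1 := by
    have := Complex.hasSum_ofReal.mpr (φ.partition ξ hξ)
    simpa [symbol] using this
  exact (hasSum_sum_of_ne_finset_zero fun j hj => φ.symbol_eq_zero j (hs j hj)).unique h

/-- The low-pass profile `∑_{j ≤ 0} φ̂_j`, extended by one to the origin. -/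
noncomputable def lowProfile (ξ : Plane) : ℂ :=
  if ‖ξ‖ < 1 / 2 then 1 else φ.symbol 0 ξ + φ.symbol (-1) ξ + φ.symbol (-2) ξ

/-- For `1/2 ≤ ‖ξ‖ < 1` only the indices `0, -1, -2` can contribute to the partition of unity, so
the three terms already add up to one. -/
theorem lowProfile_eq_one {ξ : Plane} (h : ‖ξ‖ < 1) : φ.lowProfile ξ = 1 := by
  unfold lowProfile
  split_ifs with h2
  · rfl
  · have hξ : ξ ≠ 0 := by
      rintro rfl
      simp at h2
    rw [← φ.sum_symbol_eq_one hξ (s := {0, -1, -2})]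
    · simp [add_assoc]
    · intro j hj
      have hj' : 1 ≤ j ∨ j ≤ -3 := by
        simp only [Finset.mem_insert, Finset.mem_singleton] at hj
        omega
      rcases hj' with hj | hj
      · left
        have := zpow_le_zpow_right₀ (one_le_two (α := ℝ)) hj
        rw [zpow_one] at this
        linarith
      · right
        have := zpow_le_zpow_right₀ (one_le_two (α := ℝ)) hj
        norm_num at this
        linarith

/-- The sum formula remains valid below the threshold `1/2` of the definition. It thus overlaps with
the region where the profile is constantly one, which yields smoothness across the threshold. -/
theorem lowProfile_eq_of_lt {ξ : Plane} (h : 1 / 4 < ‖ξ‖) :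
    φ.lowProfile ξ = φ.symbol 0 ξ + φ.symbol (-1) ξ + φ.symbol (-2) ξ := by
  by_cases h2 : ‖ξ‖ < 1 / 2
  · have hξ : ξ ≠ 0 := by
      rintro rfl
      norm_num at h
    rw [φ.lowProfile_eq_one (by linarith), ← φ.sum_symbol_eq_one hξ (s := {0, -1, -2})]
    · simp [add_assoc]
    · intro j hj
      have hj' : 1 ≤ j ∨ j ≤ -3 := by
        simp only [Finset.mem_insert, Finset.mem_singleton] at hj
        omega
      rcases hj' with hj | hj
      · left
        have := zpow_le_zpow_right₀ (one_le_two (α := ℝ)) hj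
        rw [zpow_one] at this
        linarith
      · right
        have := zpow_le_zpow_right₀ (one_le_two (α := ℝ)) hj
        norm_num at this
        linarith
  · rw [lowProfile, if_neg h2]

theorem lowProfile_eq_zero {ξ : Plane} (h : 2 < ‖ξ‖) : φ.lowProfile ξ = 0 := by
  rw [lowProfile, if_neg (by linarith), φ.symbol_eq_zero 0 (Or.inr (by norm_num; exact h)),
    φ.symbol_eq_zero (-1) (Or.inr (by norm_num; linarith)),
    φ.symbol_eq_zero (-2) (Or.inr (by norm_num; linarith))]
  simp

theorem contDiff_lowProfile : ContDiff ℝ ∞ φ.lowProfile := by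
  rw [contDiff_iff_contDiffAt]
  intro ξ
  by_cases h : ‖ξ‖ < 1
  · refine (contDiffAt_const (c := (1 : ℂ))).congr_of_eventuallyEq ?_
    filter_upwards [(isOpen_lt continuous_norm continuous_const).mem_nhds h] with ζ hζ
    exact φ.lowProfile_eq_one hζ
  · refine ContDiffAt.congr_of_eventuallyEq (f := fun ξ => φ.symbol 0 ξ + φ.symbol (-1) ξ +
      φ.symbol (-2) ξ) ?_ ?_
    · exact (((φ.contDiff_symbol 0).add (φ.contDiff_symbol (-1))).add
        (φ.contDiff_symbol (-2))).contDiffAt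
    · have h' : 1 / 4 < ‖ξ‖ := by linarith
      filter_upwards [(isOpen_lt continuous_const continuous_norm).mem_nhds h'] with ζ hζ
      exact φ.lowProfile_eq_of_lt hζ

theorem lowProfile_sub (ξ : Plane) :
    φ.lowProfile ξ - φ.lowProfile ((2 : ℝ) • ξ) = φ.symbol 0 ξ := by
  have hn : ‖(2 : ℝ) • ξ‖ = 2 * ‖ξ‖ := by rw [norm_smul]; norm_num
  by_cases h : ‖ξ‖ < 1 / 2
  · rw [φ.lowProfile_eq_one (by linarith), φ.lowProfile_eq_one (by linarith),
      φ.symbol_eq_zero 0 (Or.inl (by norm_num; linarith)), sub_self]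
  · rw [φ.lowProfile_eq_of_lt (by linarith), φ.lowProfile_eq_of_lt (by linarith)]
    have e := fun j => φ.symbol_smul j 1 ξ
    simp only [zpow_one] at e
    rw [e, e, e, show (-2 - 1 : ℤ) = -3 by norm_num,
      φ.symbol_eq_zero (-3) (Or.inr (by norm_num; linarith))]
    norm_num

theorem hasCompactSupport_lowProfile : HasCompactSupport φ.lowProfile := by
  refine HasCompactSupport.of_support_subset_isCompact
    (isCompact_closedBall (0 : Plane) 2) fun ξ hξ => ?_
  by_contra hn
  exact hξ (φ.lowProfile_eq_zero (by simpa using hn))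

/-- The low-pass profile as a Schwartz function. -/
noncomputable def lowSchwartz : 𝓢(Plane, ℂ) :=
  φ.hasCompactSupport_lowProfile.toSchwartzMap φ.contDiff_lowProfile

/-- The low-pass symbol `∑_{l ≤ j} φ̂_l`, extended by one to the origin. -/
noncomputable def lowSymbol (j : ℤ) : 𝓢(Plane, ℂ) := dyadicDilate φ.lowSchwartz j

theorem lowSymbol_apply (j : ℤ) (ξ : Plane) :
    φ.lowSymbol j ξ = φ.lowProfile ((2 : ℝ) ^ (-j) • ξ) := rfl

theorem norm_zpow_neg_smul (j : ℤ) (ξ : Plane) : ‖(2 : ℝ) ^ (-j) • ξ‖ = ‖ξ‖ / (2 : ℝ) ^ j := by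
  rw [norm_smul, Real.norm_of_nonneg (by positivity), zpow_neg, inv_mul_eq_div]

theorem lowSymbol_eq_one {j : ℤ} {ξ : Plane} (h : ‖ξ‖ < (2 : ℝ) ^ j) : φ.lowSymbol j ξ = 1 := by
  rw [lowSymbol_apply, φ.lowProfile_eq_one]
  rwa [norm_zpow_neg_smul, div_lt_one (by positivity)]

theorem lowSymbol_eq_zero {j : ℤ} {ξ : Plane} (h : (2 : ℝ) ^ j * 2 < ‖ξ‖) :
    φ.lowSymbol j ξ = 0 := by
  rw [lowSymbol_apply, φ.lowProfile_eq_zero]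
  rwa [norm_zpow_neg_smul, lt_div_iff₀ (by positivity), mul_comm]

/-- Makes sums of consecutive blocks telescope. -/
theorem lowSymbol_sub (j : ℤ) (ξ : Plane) :
    φ.lowSymbol j ξ - φ.lowSymbol (j - 1) ξ = φ.symbol j ξ := by
  have h := φ.lowProfile_sub ((2 : ℝ) ^ (-j) • ξ)
  rw [φ.symbol_smul, smul_smul] at h
  have e : (2 : ℝ) ^ (-(j - 1)) = 2 * 2 ^ (-j) := by
    rw [neg_sub, sub_eq_add_neg, zpow_add₀ two_ne_zero, zpow_one]
  rw [lowSymbol_apply, lowSymbol_apply, e, h]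
  simp

/-- An annular symbol that equals one on the support of `φ̂₀`. -/
noncomputable def annularProfile (ξ : Plane) : ℂ := φ.lowSymbol 2 ξ - φ.lowSymbol (-3) ξ

theorem annularProfile_eq_zero_of_lt {ξ : Plane} (h : ‖ξ‖ < 1 / 8) :
    φ.annularProfile ξ = 0 := by
  rw [annularProfile, φ.lowSymbol_eq_one (by norm_num; linarith),
    φ.lowSymbol_eq_one (by norm_num; linarith), sub_self]

theorem annularProfile_eq_zero_of_gt {ξ : Plane} (h : 8 < ‖ξ‖) : φ.annularProfile ξ = 0 := by
  rw [annularProfile, φ.lowSymbol_eq_zero (by norm_num; linarith),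
    φ.lowSymbol_eq_zero (by norm_num; linarith), sub_self]

theorem contDiff_annularProfile : ContDiff ℝ ∞ φ.annularProfile :=
  ((φ.lowSymbol 2).smooth ⊤).sub ((φ.lowSymbol (-3)).smooth ⊤)

/-- The rescaled frequencies on the support of `φ̂_j` lie in `[1/2, 2]`, where `lowSymbol 2` is one
and `lowSymbol (-3)` is zero. Hence a multiplier localized by `φ̂_j` factors through the block. -/
theorem annularProfile_mul_symbol (j : ℤ) (ξ : Plane) :
    φ.annularProfile ((2 : ℝ) ^ (-j) • ξ) * φ.symbol j ξ = φ.symbol j ξ := by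
  by_cases h : φ.symbol j ξ = 0
  · rw [h, mul_zero]
  · have hj : (0 : ℝ) < (2 : ℝ) ^ j := by positivity
    have h1 : (2 : ℝ) ^ j / 2 ≤ ‖ξ‖ := by
      by_contra! hlt
      exact h (φ.symbol_eq_zero j (Or.inl hlt))
    have h2 : ‖ξ‖ ≤ (2 : ℝ) ^ j * 2 := by
      by_contra! hlt
      exact h (φ.symbol_eq_zero j (Or.inr hlt))
    rw [annularProfile, φ.lowSymbol_eq_one, φ.lowSymbol_eq_zero, sub_zero, one_mul]
    · rw [norm_zpow_neg_smul, lt_div_iff₀ hj]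
      norm_num
      linarith
    · rw [norm_zpow_neg_smul, div_lt_iff₀ hj]
      norm_num
      linarith

/-! ### Multipliers with homogeneous symbols -/

section Homogeneous

variable {m : Plane → ℂ}

/-- `m` times the annular profile, as a Schwartz function. -/
theorem exists_schwartz_mul_annularProfile (hm : ContDiffOn ℝ ∞ m {0}ᶜ) :
    ∃ σ : 𝓢(Plane, ℂ), ∀ ξ, σ ξ = m ξ * φ.annularProfile ξ := by
  have hs : ContDiff ℝ ∞ (fun ξ => m ξ * φ.annularProfile ξ) := by
    rw [contDiff_iff_contDiffAt]
    intro ξ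
    by_cases h : ξ = 0
    · subst h
      refine (contDiffAt_const (c := (0 : ℂ))).congr_of_eventuallyEq ?_
      filter_upwards [Metric.ball_mem_nhds (0 : Plane) (by norm_num : (0 : ℝ) < 1 / 8)] with ζ hζ
      rw [φ.annularProfile_eq_zero_of_lt (by simpa using hζ), mul_zero]
    · exact (hm.contDiffAt (isOpen_compl_singleton.mem_nhds h)).mul
        φ.contDiff_annularProfile.contDiffAt
  have hc : HasCompactSupport (fun ξ => m ξ * φ.annularProfile ξ) := by
    refine HasCompactSupport.of_support_subset_isCompact
      (isCompact_closedBall (0 : Plane) 8) fun ξ hξ => ?_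
    by_contra hn
    apply hξ
    simp only [φ.annularProfile_eq_zero_of_gt (show 8 < ‖ξ‖ by simpa using hn), mul_zero]
  exact ⟨hc.toSchwartzMap hs, fun _ => rfl⟩

theorem hasTemperateGrowth_symbol (j : ℤ) : (φ.symbol j).HasTemperateGrowth := by
  simpa using φ.hasTemperateGrowth_mul_symbol j (m := fun _ => 1) contDiffOn_const

theorem localized_one (j : ℤ) (u : 𝓢'(Plane, ℂ)) :
    φ.localized (fun _ => 1) j u = φ.block j u := by
  simp [localized, block]

variable {p : ℝ≥0∞} [hp1 : Fact (1 ≤ p)]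

/-- Bernstein's inequalities for the frequency-localized pieces of a homogeneous multiplier. -/
theorem exists_distLpNorm_localized_le (hp : p ≠ ⊤) (hm : ContDiffOn ℝ ∞ m {0}ᶜ) {d : ℝ}
    (hd : ∀ c : ℝ, 0 < c → ∀ ξ, m (c • ξ) = ((c ^ d : ℝ) : ℂ) * m ξ) :
    ∃ C : ℝ≥0, 1 ≤ C ∧ ∀ (j : ℤ) (u : 𝓢'(Plane, ℂ)),
      distLpNorm p (φ.localized m j u) ≤ C * dyadicWeight d j * distLpNorm p (φ.block j u) ∧
      distLpNorm ⊤ (φ.localized m j u) ≤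
        C * dyadicWeight (d + 2 / p.toReal) j * distLpNorm p (φ.block j u) := by
  obtain ⟨σ, hσ⟩ := φ.exists_schwartz_mul_annularProfile hm
  obtain ⟨C, hC1, hC⟩ := exists_distLpNorm_dyadicDilate_le hp σ
  refine ⟨C, hC1, fun j u => ?_⟩
  have hc : (2 : ℝ) ^ (d * (j : ℝ)) = ((2 : ℝ) ^ j) ^ d := by
    rw [mul_comm, Real.rpow_mul two_pos.le, Real.rpow_intCast]
  have hc0 : (0 : ℝ) < (2 : ℝ) ^ (d * (j : ℝ)) := by positivity
  -- By homogeneity `m(ξ) = 2^{dj} m(2^{-j} ξ)`, so the localized operator is `2^{dj}` times a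
  -- dilate of the single Schwartz symbol `σ`, acting on the block.
  have key : φ.localized m j u = (((2 : ℝ) ^ (d * (j : ℝ)) : ℝ) : ℂ) •
      TemperedDistribution.fourierMultiplierCLM ℂ (dyadicDilate σ j) (φ.block j u) := by
    have hmul : (fun ξ => m ξ * φ.symbol j ξ) = (((2 : ℝ) ^ (d * (j : ℝ)) : ℝ) : ℂ) •
        (dyadicDilate σ j * φ.symbol j) := by
      funext ξ
      have e : m ξ = (((2 : ℝ) ^ (d * (j : ℝ)) : ℝ) : ℂ) * m ((2 : ℝ) ^ (-j) • ξ) := by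
        rw [hc, ← hd _ (by positivity), smul_smul, ← zpow_add₀ two_ne_zero]
        simp
      rw [Pi.smul_apply, Pi.mul_apply, dyadicDilate_apply, hσ, mul_assoc,
        φ.annularProfile_mul_symbol, smul_eq_mul, ← mul_assoc, ← e]
    rw [localized, hmul, TemperedDistribution.fourierMultiplierCLM_smul
      ((dyadicDilate σ j).hasTemperateGrowth.mul (φ.hasTemperateGrowth_symbol j)),
      smul_apply, block,
      fourierMultiplierCLM_comp_eq (dyadicDilate σ j).hasTemperateGrowth
        (φ.hasTemperateGrowth_symbol j) (m := dyadicDilate σ j * φ.symbol j) (fun _ => rfl)]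
  have hn : ‖(((2 : ℝ) ^ (d * (j : ℝ)) : ℝ) : ℂ)‖ₑ = dyadicWeight d j := by
    rw [← ofReal_norm, Complex.norm_real, Real.norm_of_nonneg hc0.le, dyadicWeight]
  have hne : (((2 : ℝ) ^ (d * (j : ℝ)) : ℝ) : ℂ) ≠ 0 := by exact_mod_cast hc0.ne'
  obtain ⟨h1, h2⟩ := hC j (φ.block j u)
  rw [key]
  constructor
  · refine (distLpNorm_smul_le _ _ hne).trans ?_
    rw [hn, mul_comm (C : ℝ≥0∞), mul_assoc]
    gcongr
  · refine (distLpNorm_smul_le _ _ hne).trans ?_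
    rw [hn, dyadicWeight_add_left, mul_left_comm, mul_assoc (dyadicWeight d j)]
    gcongr

theorem exists_distLpNorm_top_block_le (hp : p ≠ ⊤) : ∃ C : ℝ≥0, 1 ≤ C ∧
    ∀ (j : ℤ) (u : 𝓢'(Plane, ℂ)), distLpNorm ⊤ (φ.block j u) ≤
      C * dyadicWeight (2 / p.toReal) j * distLpNorm p (φ.block j u) := by
  obtain ⟨C, hC1, hC⟩ := φ.exists_distLpNorm_localized_le (m := fun _ => 1) (d := 0) hp
    contDiffOn_const (by simp)
  refine ⟨C, hC1, fun j u => ?_⟩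
  simpa [localized_one] using (hC j u).2

theorem exists_distLpNorm_block_le (hp : p ≠ ⊤) : ∃ C : ℝ≥0, 1 ≤ C ∧
    ∀ (j : ℤ) (u : 𝓢'(Plane, ℂ)), distLpNorm p (φ.block j u) ≤ C * distLpNorm p u := by
  obtain ⟨σ, hσ⟩ : ∃ σ : 𝓢(Plane, ℂ), ∀ ξ, σ ξ = φ.symbol 0 ξ := by
    refine ⟨φ.lowSymbol 0 - φ.lowSymbol (-1), fun ξ => ?_⟩
    rw [← φ.lowSymbol_sub 0 ξ]
    rfl
  obtain ⟨C, hC1, hC⟩ := exists_distLpNorm_dyadicDilate_le hp σ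
  refine ⟨C, hC1, fun j u => ?_⟩
  have : φ.symbol j = dyadicDilate σ j := by
    funext ξ
    rw [dyadicDilate_apply, hσ, φ.symbol_smul, zero_sub, neg_neg]
  rw [block, this]
  exact (hC j u).1

end Homogeneous

end LittlewoodPaley

/-! ### Homogeneous Besov spaces -/

section Besov

open LittlewoodPaley

variable (φ : LittlewoodPaley) {p : ℝ≥0∞} [hp1 : Fact (1 ≤ p)]

theorem LittlewoodPaley.hasSum_block {ι : Type*} {u : ι → 𝓢'(Plane, ℂ)} {v : 𝓢'(Plane, ℂ)}
    (h : HasSum u v) (j : ℤ) : HasSum (fun i => φ.block j (u i)) (φ.block j v) :=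
  (TemperedDistribution.fourierMultiplierCLM ℂ (φ.symbol j)).hasSum h

theorem LittlewoodPaley.hasSum_localized {ι : Type*} {u : ι → 𝓢'(Plane, ℂ)} {v : 𝓢'(Plane, ℂ)}
    (h : HasSum u v) (m : Plane → ℂ) (j : ℤ) :
    HasSum (fun i => φ.localized m j (u i)) (φ.localized m j v) :=
  (TemperedDistribution.fourierMultiplierCLM ℂ fun ξ => m ξ * φ.symbol j ξ).hasSum h

theorem LittlewoodPaley.block_zero (j : ℤ) : φ.block j 0 = 0 :=
  map_zero (TemperedDistribution.fourierMultiplierCLM ℂ (φ.symbol j))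

theorem LittlewoodPaley.block_add (j : ℤ) (u v : 𝓢'(Plane, ℂ)) :
    φ.block j (u + v) = φ.block j u + φ.block j v :=
  map_add (TemperedDistribution.fourierMultiplierCLM ℂ (φ.symbol j)) u v

theorem LittlewoodPaley.block_neg (j : ℤ) (u : 𝓢'(Plane, ℂ)) : φ.block j (-u) = -φ.block j u :=
  map_neg (TemperedDistribution.fourierMultiplierCLM ℂ (φ.symbol j)) u

theorem LittlewoodPaley.localized_sub (m : Plane → ℂ) (j : ℤ) (u v : 𝓢'(Plane, ℂ)) :
    φ.localized m j (u - v) = φ.localized m j u - φ.localized m j v :=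
  map_sub (TemperedDistribution.fourierMultiplierCLM ℂ fun ξ => m ξ * φ.symbol j ξ) u v

theorem LittlewoodPaley.localized_sum {ι : Type*} (s : Finset ι) (m : Plane → ℂ) (j : ℤ)
    (u : ι → 𝓢'(Plane, ℂ)) :
    φ.localized m j (∑ i ∈ s, u i) = ∑ i ∈ s, φ.localized m j (u i) :=
  map_sum (TemperedDistribution.fourierMultiplierCLM ℂ fun ξ => m ξ * φ.symbol j ξ) u s

/-- Both sides have the symbol `m φ̂_j φ̂_l`. Exchanging the indices moves the summation index from
the multiplier to the block, where the blocks sum up to the distribution again. -/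
theorem LittlewoodPaley.block_localized_comm {m : Plane → ℂ} (hm : ContDiffOn ℝ ∞ m {0}ᶜ) (l j : ℤ)
    (u : 𝓢'(Plane, ℂ)) : φ.block l (φ.localized m j u) = φ.block j (φ.localized m l u) := by
  unfold LittlewoodPaley.block LittlewoodPaley.localized
  rw [fourierMultiplierCLM_comp_eq (φ.hasTemperateGrowth_symbol l)
      (φ.hasTemperateGrowth_mul_symbol j hm) (m := fun ξ => m ξ * φ.symbol j ξ * φ.symbol l ξ)
      (fun ξ => by ring),
    fourierMultiplierCLM_comp_eq (φ.hasTemperateGrowth_symbol j)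
      (φ.hasTemperateGrowth_mul_symbol l hm) (m := fun ξ => m ξ * φ.symbol j ξ * φ.symbol l ξ)
      (fun ξ => by ring)]

theorem LittlewoodPaley.block_localized_eq {m : Plane → ℂ} (hm : ContDiffOn ℝ ∞ m {0}ᶜ) (l j : ℤ)
    (u : 𝓢'(Plane, ℂ)) : φ.block j (φ.localized m l u) = φ.localized m l (φ.block j u) := by
  unfold LittlewoodPaley.block LittlewoodPaley.localized
  rw [fourierMultiplierCLM_comp_eq (φ.hasTemperateGrowth_symbol j)
      (φ.hasTemperateGrowth_mul_symbol l hm) (m := fun ξ => m ξ * φ.symbol j ξ * φ.symbol l ξ)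
      (fun ξ => by ring),
    fourierMultiplierCLM_comp_eq (φ.hasTemperateGrowth_mul_symbol l hm)
      (φ.hasTemperateGrowth_symbol j) (m := fun ξ => m ξ * φ.symbol j ξ * φ.symbol l ξ)
      (fun ξ => by ring)]

theorem besovNorm_eq_tsum (s : ℝ) (u : 𝓢'(Plane, ℂ)) :
    besovNorm φ s p u = ∑' j : ℤ, dyadicWeight s j * distLpNorm p (φ.block j u) := rfl

theorem besovNorm_zero (s : ℝ) : besovNorm φ s p 0 = 0 := by
  simp [besovNorm_eq_tsum, block_zero, distLpNorm_zero]

theorem besovNorm_neg (s : ℝ) (u : 𝓢'(Plane, ℂ)) :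
    besovNorm φ s p (-u) = besovNorm φ s p u := by
  simp [besovNorm_eq_tsum, block_neg, distLpNorm_neg]

theorem besovNorm_add_le (s : ℝ) (u v : 𝓢'(Plane, ℂ)) :
    besovNorm φ s p (u + v) ≤ besovNorm φ s p u + besovNorm φ s p v := by
  rw [besovNorm_eq_tsum, besovNorm_eq_tsum, besovNorm_eq_tsum, ← ENNReal.tsum_add]
  refine ENNReal.tsum_le_tsum fun j => ?_
  rw [← mul_add, block_add]
  gcongr
  exact distLpNorm_add_le _ _

theorem besovNorm_le_tsum (s : ℝ) {ι : Type*} {u : ι → 𝓢'(Plane, ℂ)} {v : 𝓢'(Plane, ℂ)}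
    (h : HasSum u v) : besovNorm φ s p v ≤ ∑' i, besovNorm φ s p (u i) := by
  simp only [besovNorm_eq_tsum]
  rw [ENNReal.tsum_comm]
  refine ENNReal.tsum_le_tsum fun j => ?_
  rw [ENNReal.tsum_mul_left]
  gcongr
  exact distLpNorm_le_tsum (φ.hasSum_block h j)

variable {φ}

theorem MemBesov.zero (s : ℝ) : MemBesov φ s p 0 := by
  refine ⟨?_, by rw [besovNorm_zero]; exact ENNReal.zero_lt_top⟩
  simp only [block_zero]
  exact hasSum_zero

theorem MemBesov.neg {s : ℝ} {u : 𝓢'(Plane, ℂ)} (hu : MemBesov φ s p u) :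
    MemBesov φ s p (-u) := by
  refine ⟨?_, by rw [besovNorm_neg]; exact hu.2⟩
  simp only [block_neg]
  exact hu.1.neg

theorem MemBesov.add {s : ℝ} {u v : 𝓢'(Plane, ℂ)} (hu : MemBesov φ s p u)
    (hv : MemBesov φ s p v) : MemBesov φ s p (u + v) := by
  refine ⟨?_, (besovNorm_add_le φ s u v).trans_lt (ENNReal.add_lt_top.mpr ⟨hu.2, hv.2⟩)⟩
  simp only [block_add]
  exact hu.1.add hv.1

theorem MemBesov.sub {s : ℝ} {u v : 𝓢'(Plane, ℂ)} (hu : MemBesov φ s p u)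
    (hv : MemBesov φ s p v) : MemBesov φ s p (u - v) := by
  rw [sub_eq_add_neg]
  exact hu.add hv.neg

/-- A vanishing norm kills all blocks, which alone would leave polynomials; the requirement that the
blocks sum to `u` removes them. -/
theorem MemBesov.eq_zero_of_besovNorm_eq_zero {s : ℝ} {u : 𝓢'(Plane, ℂ)} (hu : MemBesov φ s p u)
    (h : besovNorm φ s p u = 0) : u = 0 := by
  have hj : ∀ j, φ.block j u = 0 := fun j => by
    rw [besovNorm_eq_tsum, ENNReal.tsum_eq_zero] at h
    exact eq_zero_of_distLpNorm_eq_zero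
      ((mul_eq_zero.mp (h j)).resolve_left (dyadicWeight_ne_zero s j))
  have := hu.1
  simp only [hj] at this
  exact this.unique hasSum_zero

variable (φ)

/-- Bernstein's inequality block by block. Summation index one is what makes the blocks absolutely
summable in `L^∞`. -/
theorem exists_tsum_distLpNorm_top_block_le (hp : p ≠ ⊤) : ∃ C : ℝ≥0, 1 ≤ C ∧
    ∀ u : 𝓢'(Plane, ℂ), ∑' j, distLpNorm ⊤ (φ.block j u) ≤
      C * besovNorm φ (2 / p.toReal) p u := by
  obtain ⟨C, hC1, hC⟩ := φ.exists_distLpNorm_top_block_le hp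
  refine ⟨C, hC1, fun u => ?_⟩
  rw [besovNorm_eq_tsum, ← ENNReal.tsum_mul_left]
  refine ENNReal.tsum_le_tsum fun j => ?_
  rw [← mul_assoc]
  exact hC j u

theorem exists_rep_top_of_memBesov (hp : p ≠ ⊤) : ∃ C : ℝ≥0,
    ∀ u : 𝓢'(Plane, ℂ), MemBesov φ (2 / p.toReal) p u →
      ∃ U : Lp ℂ ⊤ (volume : Measure Plane), (U : 𝓢'(Plane, ℂ)) = u ∧
        ‖U‖ₑ ≤ C * besovNorm φ (2 / p.toReal) p u := by
  obtain ⟨C, -, hC⟩ := exists_tsum_distLpNorm_top_block_le φ hp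
  refine ⟨C, fun u hu => ?_⟩
  obtain ⟨U, V, hU, -, hV, hle⟩ := exists_hasSum_rep_of_tsum_distLpNorm_lt_top
    ((hC u).trans_lt (ENNReal.mul_lt_top ENNReal.coe_lt_top hu.2))
  have h := hasSum_toTemperedDistribution hV
  simp only [hU] at h
  exact ⟨V, h.unique hu.1, hle.trans (hC u)⟩

/-- The Besov space is closed under series whose norms are summable. -/
theorem MemBesov.of_hasSum (hp : p ≠ ⊤) {ι : Type*} {u : ι → 𝓢'(Plane, ℂ)} {v : 𝓢'(Plane, ℂ)}
    (h : HasSum u v) (hu : ∀ i, MemBesov φ (2 / p.toReal) p (u i))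
    (ht : ∑' i, besovNorm φ (2 / p.toReal) p (u i) < ⊤) : MemBesov φ (2 / p.toReal) p v := by
  refine ⟨?_, (besovNorm_le_tsum φ _ h).trans_lt ht⟩
  obtain ⟨C, -, hC⟩ := exists_tsum_distLpNorm_top_block_le φ hp
  -- The double family is absolutely summable in `L^∞`, hence summable in `𝓢'`, and may be summed in
  -- either order: over `j` first it gives `∑ u i = v`, over `i` first it gives `∑ φ_j * v`.
  have hs : Summable fun z : ι × ℤ => φ.block z.2 (u z.1) := by
    apply summable_of_tsum_distLpNorm_lt_top (p := ⊤)
    rw [ENNReal.tsum_prod (f := fun i j => distLpNorm ⊤ (φ.block j (u i)))]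
    refine (ENNReal.tsum_le_tsum fun i => hC (u i)).trans_lt ?_
    rw [ENNReal.tsum_mul_left]
    exact ENNReal.mul_lt_top ENNReal.coe_lt_top ht
  have h1 := hs.hasSum.prod_fiberwise fun i => (hu i).1
  have h2 := ((Equiv.prodComm ℤ ι).hasSum_iff.mpr hs.hasSum).prod_fiberwise
    (g := fun j => φ.block j v) fun j => φ.hasSum_block h j
  rwa [← h.unique h1] at h2

/-- Homogeneous Fourier multipliers between homogeneous Besov spaces. -/
theorem exists_isMultiplier (hp : p ≠ ⊤) {m : Plane → ℂ} (hm : ContDiffOn ℝ ∞ m {0}ᶜ) {d : ℝ}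
    (hd : ∀ c : ℝ, 0 < c → ∀ ξ, m (c • ξ) = ((c ^ d : ℝ) : ℂ) * m ξ) :
    ∃ C : ℝ≥0, ∀ u : 𝓢'(Plane, ℂ), MemBesov φ (d + 2 / p.toReal) p u →
      ∃ w : 𝓢'(Plane, ℂ), IsMultiplier φ m u w ∧ MemBesov φ (2 / p.toReal) p w ∧
        besovNorm φ (2 / p.toReal) p w ≤ C * besovNorm φ (d + 2 / p.toReal) p u := by
  obtain ⟨C, hC1, hC⟩ := φ.exists_distLpNorm_localized_le (p := p) hp hm hd
  refine ⟨C, fun u hu => ?_⟩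
  have hle : ∑' j, distLpNorm ⊤ (φ.localized m j u) ≤
      C * besovNorm φ (d + 2 / p.toReal) p u := by
    rw [besovNorm_eq_tsum, ← ENNReal.tsum_mul_left]
    refine ENNReal.tsum_le_tsum fun j => ?_
    rw [← mul_assoc]
    exact (hC j u).2
  obtain ⟨w, hw⟩ := summable_of_tsum_distLpNorm_lt_top
    (hle.trans_lt (ENNReal.mul_lt_top ENNReal.coe_lt_top hu.2))
  -- Summing `φ_l * (m(D) φ_j * u)` over `j` reassembles `u` inside the piece localized at `l`; this
  -- is where `∑ φ_j * u = u` enters.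
  have hblock : ∀ l, φ.block l w = φ.localized m l u := by
    intro l
    have h1 := φ.hasSum_block hw l
    simp only [φ.block_localized_comm hm l] at h1
    have h2 := φ.hasSum_localized hu.1 m l
    simp only [← φ.block_localized_eq hm] at h2
    exact h1.unique h2
  have hnorm : besovNorm φ (2 / p.toReal) p w ≤ C * besovNorm φ (d + 2 / p.toReal) p u := by
    rw [besovNorm_eq_tsum, besovNorm_eq_tsum, ← ENNReal.tsum_mul_left]
    refine ENNReal.tsum_le_tsum fun j => ?_
    rw [hblock, add_comm d, dyadicWeight_add_left, mul_assoc, mul_left_comm (C : ℝ≥0∞),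
      ← mul_assoc (C : ℝ≥0∞)]
    gcongr
    exact (hC j u).1
  refine ⟨w, hw, ⟨?_, hnorm.trans_lt (ENNReal.mul_lt_top ENNReal.coe_lt_top hu.2)⟩, hnorm⟩
  simp only [hblock]
  exact hw

end Besov

/-! ### Products in homogeneous Besov spaces -/

section BesovProduct

open LittlewoodPaley

theorem tsum_dyadicWeight_sub_nat (s : ℝ) (J : ℤ) :
    ∑' n : ℕ, dyadicWeight s (J - n) = dyadicWeight s J * ∑' n : ℕ, dyadicWeight s (-n) := by
  rw [← ENNReal.tsum_mul_left]
  exact tsum_congr fun n => by rw [sub_eq_add_neg, dyadicWeight_add_right]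

theorem tsum_dyadicWeight_neg_nat_lt_top {s : ℝ} (hs : 0 < s) :
    ∑' n : ℕ, dyadicWeight s (-n) < ⊤ := by
  have h : ∀ n : ℕ, dyadicWeight s (-n) = (ENNReal.ofReal ((2 : ℝ) ^ (-s))) ^ n := by
    intro n
    rw [dyadicWeight, ← ENNReal.ofReal_pow (by positivity), ← Real.rpow_mul_natCast two_pos.le]
    push_cast
    ring_nf
  simp only [h]
  rw [ENNReal.tsum_geometric]
  have : ENNReal.ofReal ((2 : ℝ) ^ (-s)) < 1 := by
    rw [ENNReal.ofReal_lt_one]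
    exact Real.rpow_lt_one_of_one_lt_of_neg one_lt_two (by linarith)
  rw [ENNReal.inv_lt_top]
  exact tsub_pos_of_lt this

theorem toTemperedDistribution_eq_of_ae_eq {p q : ℝ≥0∞} [Fact (1 ≤ p)] [Fact (1 ≤ q)]
    {U : Lp ℂ p (volume : Measure Plane)} {V : Lp ℂ q (volume : Measure Plane)}
    (h : U =ᵐ[volume] V) : (U : 𝓢'(Plane, ℂ)) = V := by
  ext g
  rw [Lp.toTemperedDistribution_apply, Lp.toTemperedDistribution_apply]
  refine integral_congr_ae ?_
  filter_upwards [h] with x hx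
  rw [hx]

variable (φ : LittlewoodPaley) {p : ℝ≥0∞} [hp1 : Fact (1 ≤ p)]

/-- The support of `φ̂_j` reaches up to `2^{j+1}`, while the low-pass symbol is known to be one only
on an open ball; the shift by `2` leaves room. Thus a block is the image of a Schwartz multiplier.
-/
theorem LittlewoodPaley.fourierMultiplierCLM_lowSymbol_block (j : ℤ) (u : 𝓢'(Plane, ℂ)) :
    TemperedDistribution.fourierMultiplierCLM ℂ (φ.lowSymbol (j + 2)) (φ.block j u) =
      φ.block j u := by
  refine fourierMultiplierCLM_comp_eq (φ.lowSymbol (j + 2)).hasTemperateGrowth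
    (φ.hasTemperateGrowth_symbol j) (fun ξ => ?_) u
  by_cases h : φ.symbol j ξ = 0
  · rw [h, mul_zero]
  · have h2 : ‖ξ‖ ≤ (2 : ℝ) ^ j * 2 := by
      by_contra! hlt
      exact h (φ.symbol_eq_zero j (Or.inr hlt))
    have hj : (0 : ℝ) < (2 : ℝ) ^ j := by positivity
    rw [φ.lowSymbol_eq_one, one_mul]
    rw [zpow_add₀ two_ne_zero]
    norm_num
    linarith

theorem exists_lowSymbol_clm (hp : p ≠ ⊤) : ∃ C : ℝ≥0, ∀ j : ℤ,
      (∃ T : Lp ℂ p (volume : Measure Plane) →L[ℂ] Lp ℂ p (volume : Measure Plane),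
        ∀ U, (T U : 𝓢'(Plane, ℂ)) =
          TemperedDistribution.fourierMultiplierCLM ℂ (φ.lowSymbol j) (U : 𝓢'(Plane, ℂ))) ∧
      ∃ T : Lp ℂ p (volume : Measure Plane) →L[ℂ] Lp ℂ ⊤ (volume : Measure Plane),
        (∀ U, (T U : 𝓢'(Plane, ℂ)) =
          TemperedDistribution.fourierMultiplierCLM ℂ (φ.lowSymbol j) (U : 𝓢'(Plane, ℂ))) ∧
        ∀ U, ‖T U‖ₑ ≤ C * dyadicWeight (2 / p.toReal) j * ‖U‖ₑ := by
  obtain ⟨C, -, hC⟩ := exists_clm_dilation hp φ.lowSchwartz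
  refine ⟨C, fun j => ?_⟩
  obtain ⟨⟨T, hT, -⟩, S⟩ := hC j (φ.lowSymbol j) (dyadicDilate_apply _ j)
  exact ⟨⟨T, hT⟩, S⟩

/-- The product of two Littlewood--Paley blocks has no frequencies far above those of the
higher one. -/
theorem fourierMultiplierCLM_block_mul_block_eq_zero (hp : p ≠ ⊤) {j k : ℤ} (hkj : k ≤ j)
    {θ v : 𝓢'(Plane, ℂ)} {A : Lp ℂ p (volume : Measure Plane)}
    {B : Lp ℂ ⊤ (volume : Measure Plane)} (hA : (A : 𝓢'(Plane, ℂ)) = φ.block j θ)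
    (hB : (B : 𝓢'(Plane, ℂ)) = φ.block k v) (hv : distLpNorm p (φ.block k v) < ⊤)
    {m : Plane → ℂ} (hm : m.HasTemperateGrowth) (hm0 : ∀ ξ, ‖ξ‖ ≤ (2 : ℝ) ^ (j + 4) → m ξ = 0) :
    TemperedDistribution.fourierMultiplierCLM ℂ m (lpMul p B A : 𝓢'(Plane, ℂ)) = 0 := by
  obtain ⟨C, hC⟩ := exists_lowSymbol_clm φ (p := p) hp
  obtain ⟨B', hB'⟩ := exists_rep_of_distLpNorm_lt_top hv
  obtain ⟨T₂, hT₂⟩ := (hC (j + 2)).1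
  obtain ⟨T₁, hT₁, -⟩ := (hC (k + 2)).2
  have e₂ : T₂ A = A := by
    apply toTemperedDistribution_injective
    rw [hT₂, hA, φ.fourierMultiplierCLM_lowSymbol_block]
  have e₁ : T₁ B' = B := by
    apply toTemperedDistribution_injective
    rw [hT₁, hB', hB, φ.fourierMultiplierCLM_lowSymbol_block]
  rw [← e₁, ← e₂]
  -- The two low-pass symbols live in balls of radius `2^{k+3}` and `2^{j+3}`; for `k ≤ j` the radii
  -- add up to at most `2^{j+4}`.
  refine fourierMultiplierCLM_lpMul_eq_zero hp (R₁ := (2 : ℝ) ^ (k + 2) * 2)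
    (R₂ := (2 : ℝ) ^ (j + 2) * 2) (fun ξ h => φ.lowSymbol_eq_zero h)
    (fun ξ h => φ.lowSymbol_eq_zero h) hm (fun ξ h => hm0 ξ (h.trans ?_)) hT₁ hT₂ B' A
  have h1 : (2 : ℝ) ^ (k + 2) ≤ 2 ^ (j + 2) := zpow_le_zpow_right₀ one_le_two (by omega)
  have h2 : (2 : ℝ) ^ (j + 4) = 2 ^ (j + 2) * 4 := by
    rw [show j + 4 = (j + 2) + 2 by ring, zpow_add₀ two_ne_zero (j + 2)]
    norm_num
  linarith

/-- A function in `L^p` with frequencies in a ball belongs to the homogeneous Besov space. -/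
theorem exists_besovNorm_le_of_bandlimited (hp : p ≠ ⊤) : ∃ C : ℝ≥0,
    ∀ (j : ℤ) (a : 𝓢'(Plane, ℂ)), distLpNorm p a < ⊤ →
      (∀ m : Plane → ℂ, m.HasTemperateGrowth → (∀ ξ, ‖ξ‖ ≤ (2 : ℝ) ^ (j + 4) → m ξ = 0) →
        TemperedDistribution.fourierMultiplierCLM ℂ m a = 0) →
      MemBesov φ (2 / p.toReal) p a ∧ besovNorm φ (2 / p.toReal) p a ≤
        C * (dyadicWeight (2 / p.toReal) j * distLpNorm p a) := by
  have hs : 0 < 2 / p.toReal := div_pos two_pos (ENNReal.toReal_pos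
    (zero_lt_one.trans_le hp1.out).ne' hp)
  set s := 2 / p.toReal with hs_def
  obtain ⟨D, -, hD⟩ := φ.exists_distLpNorm_block_le hp
  obtain ⟨E, hE⟩ := exists_lowSymbol_clm φ hp
  have hG := tsum_dyadicWeight_neg_nat_lt_top hs
  set G := ∑' n : ℕ, dyadicWeight s (-n) with hG_def
  -- Only blocks of index `l = j + 6 - n` with `n ≥ 0` can be nonzero, and each is bounded by `D
  -- ‖a‖_p`. Summing `2^{s(j+6-n)}` over `n` gives `2^{sj} 2^{6s} G`, with `G` finite because `s >
  -- 0`.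
  refine ⟨D * (dyadicWeight s 6 * G).toNNReal, fun j a ha hm => ?_⟩
  have hinj : Function.Injective fun n : ℕ => j + 6 - (n : ℤ) := fun x y h => by
    simp only at h
    omega
  have hhigh : ∀ l, l ∉ Set.range (fun n : ℕ => j + 6 - (n : ℤ)) → φ.block l a = 0 := by
    intro l hl
    have hl' : j + 7 ≤ l := by
      by_contra! hlt
      exact hl ⟨(j + 6 - l).toNat, by simp only; omega⟩
    refine hm _ (φ.hasTemperateGrowth_symbol l) fun ξ hξ => φ.symbol_eq_zero l (Or.inl ?_)
    have h1 : (2 : ℝ) ^ (j + 4 + 3) ≤ 2 ^ l := zpow_le_zpow_right₀ one_le_two (by omega)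
    have h2 : (0 : ℝ) < 2 ^ (j + 4) := by positivity
    rw [zpow_add₀ two_ne_zero] at h1
    norm_num at h1
    linarith
  have hnorm : besovNorm φ s p a ≤ (D * (dyadicWeight s 6 * G).toNNReal : ℝ≥0) *
      (dyadicWeight s j * distLpNorm p a) := by
    rw [besovNorm_eq_tsum, ← hinj.tsum_eq]
    · calc ∑' n : ℕ, dyadicWeight s (j + 6 - n) * distLpNorm p (φ.block (j + 6 - n) a)
          ≤ ∑' n : ℕ, dyadicWeight s (j + 6 - n) * (D * distLpNorm p a) :=
            ENNReal.tsum_le_tsum fun n => by gcongr; exact hD _ _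
        _ = (D * (dyadicWeight s 6 * G).toNNReal : ℝ≥0) *
            (dyadicWeight s j * distLpNorm p a) := by
          rw [ENNReal.tsum_mul_right, tsum_dyadicWeight_sub_nat, ← hG_def,
            dyadicWeight_add_right, ENNReal.coe_mul, ENNReal.coe_toNNReal
            (ENNReal.mul_ne_top (dyadicWeight_ne_top _ _) hG.ne)]
          ring
    · intro l hl
      by_contra hn
      exact hl (by simp only [hhigh l hn, distLpNorm_zero, mul_zero])
  have hfin : besovNorm φ s p a < ⊤ := hnorm.trans_lt (ENNReal.mul_lt_top ENNReal.coe_lt_top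
    (ENNReal.mul_lt_top (dyadicWeight_ne_top _ _).lt_top ha))
  refine ⟨⟨?_, hfin⟩, hnorm⟩
  rw [← hinj.hasSum_iff (fun l hl => hhigh l hl)]
  -- Unconditional summability holds by the `L^∞` bound on the blocks. It remains to identify the
  -- sum, for which partial sums in the natural order suffice.
  have hsum' : Summable ((fun l => φ.block l a) ∘ fun n : ℕ => j + 6 - (n : ℤ)) := by
    obtain ⟨C, -, hC⟩ := exists_tsum_distLpNorm_top_block_le φ hp
    exact summable_of_tsum_distLpNorm_lt_top
      ((ENNReal.tsum_comp_le_tsum_of_injective hinj fun l => distLpNorm ⊤ (φ.block l a)).trans_lt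
        ((hC a).trans_lt (ENNReal.mul_lt_top ENNReal.coe_lt_top hfin)))
  set low : ℤ → 𝓢'(Plane, ℂ) := fun l =>
    TemperedDistribution.fourierMultiplierCLM ℂ (φ.lowSymbol l) a with hlow
  have htel : ∀ l, φ.block l a = low l - low (l - 1) := by
    intro l
    rw [hlow, block, ← fourierMultiplierCLM_sub_apply (φ.lowSymbol l).hasTemperateGrowth
      (φ.lowSymbol (l - 1)).hasTemperateGrowth]
    congr 2
    funext ξ
    exact (φ.lowSymbol_sub l ξ).symm
  -- The symbol `1 - lowSymbol (j + 6)` vanishes on the frequency ball of `a`, so the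
  -- band-limitation hypothesis applies to it.
  have htop : low (j + 6) = a := by
    have h := hm ((fun _ : Plane => (1 : ℂ)) - ⇑(φ.lowSymbol (j + 6)))
      ((Function.HasTemperateGrowth.const 1).sub (φ.lowSymbol (j + 6)).hasTemperateGrowth)
      fun ξ hξ => by
        rw [Pi.sub_apply, φ.lowSymbol_eq_one, sub_self]
        exact hξ.trans_lt (zpow_lt_zpow_right₀ one_lt_two (by omega))
    rw [fourierMultiplierCLM_sub_apply (Function.HasTemperateGrowth.const 1)
      (φ.lowSymbol (j + 6)).hasTemperateGrowth, TemperedDistribution.fourierMultiplierCLM_const,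
      one_smul, sub_eq_zero] at h
    exact h.symm
  -- No polynomial is left at frequency zero: by Bernstein the low-pass part at level `l` has `L^∞`
  -- norm at most a constant times `2^{sl} ‖a‖_p`, which is summable as `l → -∞`.
  have hzero : Filter.Tendsto (fun n : ℕ => low (j + 6 - n)) Filter.atTop (nhds 0) := by
    apply Summable.tendsto_atTop_zero
    apply summable_of_tsum_distLpNorm_lt_top (p := ⊤)
    obtain ⟨A, rfl⟩ := exists_rep_of_distLpNorm_lt_top ha
    have hle : ∀ l : ℤ, distLpNorm ⊤ (low l) ≤ dyadicWeight s l * (E * ‖A‖ₑ) := by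
      intro l
      obtain ⟨T, hT, hT'⟩ := (hE l).2
      rw [hlow]
      simp only
      rw [← hT, distLpNorm_coe, ← mul_assoc, mul_comm _ (E : ℝ≥0∞)]
      exact hT' A
    refine (ENNReal.tsum_le_tsum fun n => hle (j + 6 - (n : ℕ))).trans_lt ?_
    rw [ENNReal.tsum_mul_right, tsum_dyadicWeight_sub_nat]
    exact ENNReal.mul_lt_top (ENNReal.mul_lt_top (dyadicWeight_ne_top _ _).lt_top hG)
      (ENNReal.mul_lt_top ENNReal.coe_lt_top enorm_lt_top)
  have hpart : ∀ N : ℕ, ∑ n ∈ Finset.range N,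
      ((fun l => φ.block l a) ∘ fun n : ℕ => j + 6 - (n : ℤ)) n = a - low (j + 6 - N) := by
    intro N
    have := Finset.sum_range_sub' (fun n : ℕ => low (j + 6 - n)) N
    rw [Nat.cast_zero, sub_zero, htop] at this
    rw [← this]
    refine Finset.sum_congr rfl fun n _ => ?_
    rw [Function.comp_apply, htel, Nat.cast_succ, sub_sub]
  have hlim : Filter.Tendsto (fun N : ℕ => a - low (j + 6 - N)) Filter.atTop (nhds a) := by
    simpa using tendsto_const_nhds.sub hzero
  have h1 := hsum'.hasSum.tendsto_sum_nat
  simp only [hpart] at h1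
  have h2 := hsum'.hasSum
  rwa [← tendsto_nhds_unique hlim h1] at h2

/-- The higher frequency `j` fixes the band limit and hence the weight `2^{sj}`. The lower-frequency
factor is put in `L^∞`, where Bernstein costs exactly `2^{sk}`. -/
theorem exists_besovNorm_block_mul_block_le (hp : p ≠ ⊤) : ∃ C : ℝ≥0,
    ∀ (j k : ℤ) (θ v : 𝓢'(Plane, ℂ)) (A : Lp ℂ p (volume : Measure Plane))
      (B : Lp ℂ ⊤ (volume : Measure Plane)), k ≤ j → (A : 𝓢'(Plane, ℂ)) = φ.block j θ →
      (B : 𝓢'(Plane, ℂ)) = φ.block k v → distLpNorm p (φ.block k v) < ⊤ →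
      MemBesov φ (2 / p.toReal) p (lpMul p B A : 𝓢'(Plane, ℂ)) ∧
      besovNorm φ (2 / p.toReal) p (lpMul p B A : 𝓢'(Plane, ℂ)) ≤
        C * ((dyadicWeight (2 / p.toReal) j * distLpNorm p (φ.block j θ)) *
          (dyadicWeight (2 / p.toReal) k * distLpNorm p (φ.block k v))) := by
  obtain ⟨C, hC⟩ := exists_besovNorm_le_of_bandlimited φ hp
  obtain ⟨D, -, hD⟩ := φ.exists_distLpNorm_top_block_le hp
  refine ⟨C * D, fun j k θ v A B hkj hA hB hv => ?_⟩
  obtain ⟨h1, h2⟩ := hC j (lpMul p B A : 𝓢'(Plane, ℂ))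
    (by rw [distLpNorm_coe]; exact enorm_lt_top)
    fun m hm hm0 => fourierMultiplierCLM_block_mul_block_eq_zero φ hp hkj hA hB hv hm hm0
  refine ⟨h1, h2.trans ?_⟩
  have h3 : distLpNorm p (lpMul p B A : 𝓢'(Plane, ℂ)) ≤
      (D * dyadicWeight (2 / p.toReal) k * distLpNorm p (φ.block k v)) *
        distLpNorm p (φ.block j θ) := by
    rw [distLpNorm_coe]
    refine (enorm_lpMul_le B A).trans ?_
    rw [← distLpNorm_coe A, ← distLpNorm_coe B, hA, hB]
    gcongr
    exact hD k v
  calc (C : ℝ≥0∞) * (dyadicWeight (2 / p.toReal) j * distLpNorm p (lpMul p B A : 𝓢'(Plane, ℂ)))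
      ≤ C * (dyadicWeight (2 / p.toReal) j *
          ((D * dyadicWeight (2 / p.toReal) k * distLpNorm p (φ.block k v)) *
            distLpNorm p (φ.block j θ))) := by gcongr
    _ = _ := by
      push_cast
      ring

/-- The Cauchy product of two absolutely convergent series in the Banach algebra `L^∞`. -/
theorem hasSum_lpMul {ι κ : Type*} {F : ι → Lp ℂ ⊤ (volume : Measure Plane)}
    {H : κ → Lp ℂ ⊤ (volume : Measure Plane)} {Θ V : Lp ℂ ⊤ (volume : Measure Plane)}
    (hF : Summable fun j => ‖F j‖) (hH : Summable fun k => ‖H k‖) (hΘ : HasSum F Θ)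
    (hV : HasSum H V) :
    HasSum (fun z : ι × κ => lpMul ⊤ (F z.1) (H z.2)) (lpMul ⊤ Θ V) := by
  have hsum : Summable fun z : ι × κ => lpMul ⊤ (F z.1) (H z.2) :=
    Summable.of_norm_bounded (hF.mul_of_nonneg hH (fun _ => norm_nonneg _)
      (fun _ => norm_nonneg _)) fun z => norm_lpMul_le _ _
  obtain ⟨W, hW⟩ := hsum
  have h1 : HasSum (fun j => lpMul ⊤ (F j) V) W :=
    hW.prod_fiberwise fun j => (lpMul ⊤ (F j)).hasSum hV
  have h2 : HasSum (fun j => lpMul ⊤ (F j) V) (lpMul ⊤ Θ V) := ((lpMul ⊤).flip V).hasSum hΘ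
  rwa [← h2.unique h1] at hW

set_option maxHeartbeats 800000 in
-- By symmetry the factor of higher frequency may be either one. Its `L^∞` representative is
-- exchanged for an `L^p` one, which agrees with it almost everywhere.
theorem exists_besovNorm_lpMul_top_block_le (hp : p ≠ ⊤) : ∃ C : ℝ≥0,
    ∀ (j k : ℤ) (θ v : 𝓢'(Plane, ℂ)) (A B : Lp ℂ ⊤ (volume : Measure Plane)),
      (A : 𝓢'(Plane, ℂ)) = φ.block j θ → (B : 𝓢'(Plane, ℂ)) = φ.block k v →
      distLpNorm p (φ.block j θ) < ⊤ → distLpNorm p (φ.block k v) < ⊤ →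
      MemBesov φ (2 / p.toReal) p (lpMul ⊤ A B : 𝓢'(Plane, ℂ)) ∧
      besovNorm φ (2 / p.toReal) p (lpMul ⊤ A B : 𝓢'(Plane, ℂ)) ≤
        C * ((dyadicWeight (2 / p.toReal) j * distLpNorm p (φ.block j θ)) *
          (dyadicWeight (2 / p.toReal) k * distLpNorm p (φ.block k v))) := by
  obtain ⟨C, hC⟩ := exists_besovNorm_block_mul_block_le φ hp
  refine ⟨C, fun j k θ v A B hA hB hθ hv => ?_⟩
  rcases le_total k j with hkj | hjk
  · obtain ⟨A', hA'⟩ := exists_rep_of_distLpNorm_lt_top hθ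
    have e : Lp.toTemperedDistribution (lpMul ⊤ A B) =
        Lp.toTemperedDistribution (lpMul p B A') := by
      apply toTemperedDistribution_eq_of_ae_eq
      filter_upwards [coeFn_lpMul A B, coeFn_lpMul B A',
        ae_eq_of_toTemperedDistribution_eq (hA.trans hA'.symm)] with x h1 h2 h3
      rw [h1, h2, h3, mul_comm]
    rw [e]
    exact hC j k θ v A' B hkj hA' hB hv
  · obtain ⟨B', hB'⟩ := exists_rep_of_distLpNorm_lt_top hv
    have e : Lp.toTemperedDistribution (lpMul ⊤ A B) =
        Lp.toTemperedDistribution (lpMul p A B') := by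
      apply toTemperedDistribution_eq_of_ae_eq
      filter_upwards [coeFn_lpMul A B, coeFn_lpMul A B',
        ae_eq_of_toTemperedDistribution_eq (hB.trans hB'.symm)] with x h1 h2 h3
      rw [h1, h2, h3]
    rw [e, mul_comm (dyadicWeight (2 / p.toReal) j * _)]
    exact hC k j v θ B' A hjk hB' hA hθ

theorem exists_hasSum_rep_block (hp : p ≠ ⊤) {u : 𝓢'(Plane, ℂ)}
    {U : Lp ℂ ⊤ (volume : Measure Plane)} (hu : MemBesov φ (2 / p.toReal) p u)
    (hU : (U : 𝓢'(Plane, ℂ)) = u) :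
    ∃ W : ℤ → Lp ℂ ⊤ (volume : Measure Plane), (∀ j, (W j : 𝓢'(Plane, ℂ)) = φ.block j u) ∧
      Summable (fun j => ‖W j‖) ∧ HasSum W U := by
  obtain ⟨D, -, hD⟩ := exists_tsum_distLpNorm_top_block_le φ hp
  obtain ⟨W, U', hW, hWs, hWU, -⟩ := exists_hasSum_rep_of_tsum_distLpNorm_lt_top
    ((hD u).trans_lt (ENNReal.mul_lt_top ENNReal.coe_lt_top hu.2))
  have h := hasSum_toTemperedDistribution hWU
  simp only [hW] at h
  have e : U' = U := toTemperedDistribution_injective (by rw [h.unique hu.1, hU])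
  exact ⟨W, hW, hWs, e ▸ hWU⟩

variable {φ} in
theorem MemBesov.distLpNorm_block_lt_top {s : ℝ} {u : 𝓢'(Plane, ℂ)} (hu : MemBesov φ s p u)
    (j : ℤ) : distLpNorm p (φ.block j u) < ⊤ := by
  have h := ENNReal.ne_top_of_tsum_ne_top hu.2.ne j
  exact ENNReal.lt_top_of_mul_ne_top_right h (dyadicWeight_ne_zero _ j)

/-- The homogeneous Besov space with `s = 2/p` is an algebra under multiplication. -/
theorem exists_besovNorm_mul_le (hp : p ≠ ⊤) : ∃ C : ℝ≥0,
    ∀ (θ v : 𝓢'(Plane, ℂ)) (Θ V : Lp ℂ ⊤ (volume : Measure Plane)),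
      MemBesov φ (2 / p.toReal) p θ → MemBesov φ (2 / p.toReal) p v →
      (Θ : 𝓢'(Plane, ℂ)) = θ → (V : 𝓢'(Plane, ℂ)) = v →
      MemBesov φ (2 / p.toReal) p (lpMul ⊤ Θ V : 𝓢'(Plane, ℂ)) ∧
      besovNorm φ (2 / p.toReal) p (lpMul ⊤ Θ V : 𝓢'(Plane, ℂ)) ≤
        C * (besovNorm φ (2 / p.toReal) p θ * besovNorm φ (2 / p.toReal) p v) := by
  obtain ⟨C, hC⟩ := exists_besovNorm_lpMul_top_block_le φ hp
  refine ⟨C, fun θ v Θ V hθ hv hΘ hV => ?_⟩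
  obtain ⟨F, hF, hFs, hFΘ⟩ := exists_hasSum_rep_block φ hp hθ hΘ
  obtain ⟨H, hH, hHs, hHV⟩ := exists_hasSum_rep_block φ hp hv hV
  have hatom := fun z : ℤ × ℤ => hC z.1 z.2 θ v (F z.1) (H z.2) (hF z.1) (hH z.2)
    (hθ.distLpNorm_block_lt_top z.1) (hv.distLpNorm_block_lt_top z.2)
  -- The bound for a pair is a product of one term of each Besov series, so the double sum is the
  -- product of the two norms.
  have htot : ∑' z : ℤ × ℤ,
      besovNorm φ (2 / p.toReal) p (lpMul ⊤ (F z.1) (H z.2) : 𝓢'(Plane, ℂ)) ≤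
        C * (besovNorm φ (2 / p.toReal) p θ * besovNorm φ (2 / p.toReal) p v) := by
    refine (ENNReal.tsum_le_tsum fun z => (hatom z).2).trans (le_of_eq ?_)
    rw [ENNReal.tsum_mul_left, ENNReal.tsum_prod (f := fun j k =>
      (dyadicWeight (2 / p.toReal) j * distLpNorm p (φ.block j θ)) *
          (dyadicWeight (2 / p.toReal) k * distLpNorm p (φ.block k v)))]
    simp only [ENNReal.tsum_mul_left, ENNReal.tsum_mul_right]
    rfl
  have hcoe := hasSum_toTemperedDistribution (hasSum_lpMul hFs hHs hFΘ hHV)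
  refine ⟨MemBesov.of_hasSum φ hp hcoe (fun z => (hatom z).1) (htot.trans_lt ?_),
    (besovNorm_le_tsum φ _ hcoe).trans htot⟩
  exact ENNReal.mul_lt_top ENNReal.coe_lt_top (ENNReal.mul_lt_top hθ.2 hv.2)

end BesovProduct

/-! ### Quadratic equations in Banach spaces -/

section FixedPoint

variable {E : Type*} [NormedAddCommGroup E] {Q : E → E → E} {C : ℝ}

/-- Split `Q x x - Q x' x' = Q (x - x') x + Q x' (x - x')`; the radius `1/(4C)` makes each term at
most a quarter of `‖x - x'‖`. -/
theorem norm_sub_le_of_quadratic (hC : 0 < C) (hl : ∀ x x' y, Q (x - x') y = Q x y - Q x' y)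
    (hr : ∀ x y y', Q x (y - y') = Q x y - Q x y') (hQ : ∀ x y, ‖Q x y‖ ≤ C * ‖x‖ * ‖y‖)
    {x x' : E} (hx : ‖x‖ ≤ 1 / (4 * C)) (hx' : ‖x'‖ ≤ 1 / (4 * C)) :
    ‖Q x x - Q x' x'‖ ≤ 1 / 2 * ‖x - x'‖ := by
  have e : Q x x - Q x' x' = Q (x - x') x + Q x' (x - x') := by
    rw [hl, hr]
    abel
  have h1 : C * ‖x - x'‖ * ‖x‖ ≤ 1 / 4 * ‖x - x'‖ := by
    calc C * ‖x - x'‖ * ‖x‖ ≤ C * ‖x - x'‖ * (1 / (4 * C)) := by gcongr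
      _ = 1 / 4 * ‖x - x'‖ := by field_simp
  have h2 : C * ‖x'‖ * ‖x - x'‖ ≤ 1 / 4 * ‖x - x'‖ := by
    calc C * ‖x'‖ * ‖x - x'‖ ≤ C * (1 / (4 * C)) * ‖x - x'‖ := by gcongr
      _ = 1 / 4 * ‖x - x'‖ := by field_simp
  rw [e]
  linarith [norm_add_le (Q (x - x') x) (Q x' (x - x')), hQ (x - x') x, hQ x' (x - x')]

/-- The quadratic difference is at most `‖x - x'‖ / 2` and is absorbed on the left. This yields both
uniqueness and Lipschitz dependence. -/
theorem norm_sub_le_of_quadratic_eq (hC : 0 < C)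
    (hl : ∀ x x' y, Q (x - x') y = Q x y - Q x' y)
    (hr : ∀ x y y', Q x (y - y') = Q x y - Q x y') (hQ : ∀ x y, ‖Q x y‖ ≤ C * ‖x‖ * ‖y‖)
    {x x' y y' : E} (hx : ‖x‖ ≤ 1 / (4 * C)) (hx' : ‖x'‖ ≤ 1 / (4 * C))
    (e : x = y - Q x x) (e' : x' = y' - Q x' x') : ‖x - x'‖ ≤ 2 * ‖y - y'‖ := by
  have h := norm_sub_le_of_quadratic hC hl hr hQ hx hx'
  have h2 : x - x' = (y - y') - (Q x x - Q x' x') := by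
    conv_lhs => rw [e, e']
    abel
  have h3 := norm_sub_le (y - y') (Q x x - Q x' x')
  rw [← h2] at h3
  linarith

/-- Banach's fixed point theorem on the ball of radius `1/(4C)`, which is mapped to itself since
`1/(8C) + 1/(16C) ≤ 1/(4C)`. -/
theorem exists_quadratic_eq [CompleteSpace E] (hC : 0 < C)
    (hl : ∀ x x' y, Q (x - x') y = Q x y - Q x' y)
    (hr : ∀ x y y', Q x (y - y') = Q x y - Q x y') (hQ : ∀ x y, ‖Q x y‖ ≤ C * ‖x‖ * ‖y‖)
    {y : E} (hy : ‖y‖ ≤ 1 / (8 * C)) : ∃ x, ‖x‖ ≤ 1 / (4 * C) ∧ x = y - Q x x := by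
  set s := Metric.closedBall (0 : E) (1 / (4 * C)) with hs
  have hmaps : Set.MapsTo (fun x => y - Q x x) s s := by
    intro x hx
    rw [hs, mem_closedBall_zero_iff] at hx ⊢
    have h2 : C * ‖x‖ * ‖x‖ ≤ C * (1 / (4 * C)) * (1 / (4 * C)) := by gcongr
    have h3 : C * (1 / (4 * C)) * (1 / (4 * C)) = 1 / (8 * C) / 2 := by
      field_simp
      norm_num
    have h4 : 1 / (4 * C) = 2 * (1 / (8 * C)) := by
      field_simp
      norm_num
    have h5 : 0 < 1 / (8 * C) := by positivity
    linarith [norm_sub_le y (Q x x), hQ x x]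
  have hcontr : ContractingWith (1 / 2) (hmaps.restrict (fun x => y - Q x x) s s) := by
    refine ⟨by rw [← NNReal.coe_lt_coe]; norm_num, LipschitzWith.of_dist_le_mul fun a b => ?_⟩
    have ha := mem_closedBall_zero_iff.mp a.2
    have hb := mem_closedBall_zero_iff.mp b.2
    rw [Subtype.dist_eq, Subtype.dist_eq, dist_eq_norm, dist_eq_norm, Set.MapsTo.val_restrict_apply,
      Set.MapsTo.val_restrict_apply, sub_sub_sub_cancel_left, norm_sub_rev]
    exact norm_sub_le_of_quadratic hC hl hr hQ ha hb
  obtain ⟨x, hx, hfix, -⟩ := hcontr.exists_fixedPoint' Metric.isClosed_closedBall.isComplete hmaps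
    (x := 0) (Metric.mem_closedBall_self (by positivity)) (edist_ne_top _ _)
  exact ⟨x, mem_closedBall_zero_iff.mp hx, hfix.symm⟩

end FixedPoint

/-! ### The homogeneous Besov space as a Banach space -/

section BesovSpace

variable (φ : LittlewoodPaley) (p : ℝ≥0∞) [hp1 : Fact (1 ≤ p)]

/-- The homogeneous Besov space as an additive subgroup of the tempered distributions. -/
def besovSubgroup (s : ℝ) : AddSubgroup (𝓢'(Plane, ℂ)) where
  carrier := {u | MemBesov φ s p u}
  add_mem' := MemBesov.add
  zero_mem' := MemBesov.zero s
  neg_mem' := MemBesov.neg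

/-- The homogeneous Besov space with `s = 2/p`. -/
def BesovSpace : Type := besovSubgroup φ p (2 / p.toReal)

noncomputable instance : AddCommGroup (BesovSpace φ p) :=
  inferInstanceAs (AddCommGroup (besovSubgroup φ p (2 / p.toReal)))

variable {φ p}

namespace BesovSpace

/-- The inclusion of the Besov space into the tempered distributions. -/
noncomputable def toDist : BesovSpace φ p →+ 𝓢'(Plane, ℂ) :=
  (besovSubgroup φ p (2 / p.toReal)).subtype

theorem memBesov (u : BesovSpace φ p) : MemBesov φ (2 / p.toReal) p u.toDist := Subtype.prop u

theorem toDist_injective : Function.Injective (toDist : BesovSpace φ p → 𝓢'(Plane, ℂ)) :=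
  Subtype.val_injective

/-- The element of the Besov space given by a distribution. -/
def mk (u : 𝓢'(Plane, ℂ)) (hu : MemBesov φ (2 / p.toReal) p u) : BesovSpace φ p :=
  (⟨u, hu⟩ : besovSubgroup φ p (2 / p.toReal))

theorem toDist_mk (u : 𝓢'(Plane, ℂ)) (hu : MemBesov φ (2 / p.toReal) p u) :
    (mk u hu).toDist = u := rfl

variable (φ p) in
/-- The Besov norm as a group norm. -/
noncomputable def groupNorm : AddGroupNorm (BesovSpace φ p) where
  toFun u := (besovNorm φ (2 / p.toReal) p u.toDist).toReal
  map_zero' := by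
    rw [map_zero, besovNorm_zero, ENNReal.toReal_zero]
  add_le' u v := by
    rw [← ENNReal.toReal_add u.memBesov.2.ne v.memBesov.2.ne, map_add]
    exact ENNReal.toReal_mono (ENNReal.add_ne_top.mpr ⟨u.memBesov.2.ne, v.memBesov.2.ne⟩)
      (besovNorm_add_le φ _ _ _)
  neg' u := by rw [map_neg, besovNorm_neg]
  eq_zero_of_map_eq_zero' u h := by
    have h0 : besovNorm φ (2 / p.toReal) p u.toDist = 0 :=
      ((ENNReal.toReal_eq_zero_iff _).mp h).resolve_right u.memBesov.2.ne
    exact toDist_injective (MemBesov.eq_zero_of_besovNorm_eq_zero u.memBesov h0)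

noncomputable instance : NormedAddCommGroup (BesovSpace φ p) :=
  (groupNorm φ p).toNormedAddCommGroup

theorem norm_eq (u : BesovSpace φ p) : ‖u‖ = (besovNorm φ (2 / p.toReal) p u.toDist).toReal := rfl

theorem ofReal_norm_eq (u : BesovSpace φ p) :
    ENNReal.ofReal ‖u‖ = besovNorm φ (2 / p.toReal) p u.toDist :=
  ENNReal.ofReal_toReal u.memBesov.2.ne

theorem norm_le_iff (u : BesovSpace φ p) {r : ℝ} (hr : 0 ≤ r) :
    ‖u‖ ≤ r ↔ besovNorm φ (2 / p.toReal) p u.toDist ≤ ENNReal.ofReal r := by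
  rw [← ofReal_norm_eq, ENNReal.ofReal_le_ofReal_iff hr]

/-- Absolutely convergent series converge: the embedding into `L^∞` produces the sum in `𝓢'`, and
subadditivity over series bounds the remainders by tails of the norm series. -/
theorem completeSpace (hp : p ≠ ⊤) : CompleteSpace (BesovSpace φ p) := by
  refine NormedAddCommGroup.completeSpace_of_summable_imp_tendsto fun u hu => ?_
  have ht : ∑' n, besovNorm φ (2 / p.toReal) p (u n).toDist < ⊤ := by
    simp only [← ofReal_norm_eq]
    rw [← ENNReal.ofReal_tsum_of_nonneg (fun n => norm_nonneg _) hu]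
    exact ENNReal.ofReal_lt_top
  obtain ⟨C, hC⟩ := exists_rep_top_of_memBesov φ hp
  have hs : Summable fun n => (u n).toDist := by
    apply summable_of_tsum_distLpNorm_lt_top (p := ⊤)
    have hle : ∀ n, distLpNorm ⊤ (u n).toDist ≤
        C * besovNorm φ (2 / p.toReal) p (u n).toDist := by
      intro n
      obtain ⟨U, hU, hle⟩ := hC (u n).toDist (u n).memBesov
      rw [← hU, distLpNorm_coe, hU]
      exact hle
    refine (ENNReal.tsum_le_tsum hle).trans_lt ?_
    rw [ENNReal.tsum_mul_left]
    exact ENNReal.mul_lt_top ENNReal.coe_lt_top ht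
  obtain ⟨a, ha⟩ := hs
  refine ⟨mk a (MemBesov.of_hasSum φ hp ha (fun n => (u n).memBesov) ht), ?_⟩
  rw [tendsto_iff_norm_sub_tendsto_zero]
  have htail := ENNReal.tendsto_sum_nat_add
    (fun n => besovNorm φ (2 / p.toReal) p (u n).toDist) ht.ne
  have htail' := (ENNReal.tendsto_toReal ENNReal.zero_ne_top).comp htail
  refine squeeze_zero (fun _ => norm_nonneg _) (fun N => ?_) htail'
  rw [norm_sub_rev, Function.comp_apply, norm_eq]
  refine ENNReal.toReal_mono ?_ ?_
  · exact ((ENNReal.tsum_comp_le_tsum_of_injective (add_left_injective N) _).trans_lt ht).ne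
  · rw [map_sub, map_sum, toDist_mk]
    exact besovNorm_le_tsum φ _ ((hasSum_nat_add_iff' N).mpr ha)

end BesovSpace

end BesovSpace

/-! ### The stationary quasi-geostrophic equation as a fixed point equation -/

section QuasiGeostrophic

open LittlewoodPaley

theorem fracLaplacianSymbol_smul (α : ℝ) {c : ℝ} (hc : 0 < c) (ξ : Plane) :
    fracLaplacianSymbol α (c • ξ) = ((c ^ (2 * α) : ℝ) : ℂ) * fracLaplacianSymbol α ξ := by
  have hπ := Real.pi_pos
  rw [fracLaplacianSymbol, fracLaplacianSymbol, ← Complex.ofReal_mul, norm_smul,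
    Real.norm_of_nonneg hc.le, ← Real.mul_rpow hc.le (by positivity), mul_left_comm]

theorem partialSymbol_smul (k : Fin 2) (c : ℝ) (ξ : Plane) :
    partialSymbol k (c • ξ) = (c : ℂ) * partialSymbol k ξ := by
  simp only [partialSymbol, PiLp.smul_apply, smul_eq_mul, Complex.ofReal_mul]
  ring

theorem partialSymbol_mul_fracLaplacianSymbol_smul (k : Fin 2) {c : ℝ} (hc : 0 < c) (ξ : Plane) :
    partialSymbol k (c • ξ) * fracLaplacianSymbol (-(1 / 2)) (c • ξ) =
      partialSymbol k ξ * fracLaplacianSymbol (-(1 / 2)) ξ := by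
  rw [partialSymbol_smul, fracLaplacianSymbol_smul _ hc]
  have : ((c ^ (2 * (-(1 / 2)) : ℝ) : ℝ) : ℂ) = (c : ℂ)⁻¹ := by
    rw [show (2 * (-(1 / 2)) : ℝ) = -1 by norm_num, Real.rpow_neg_one, Complex.ofReal_inv]
  rw [this]
  have hc' : (c : ℂ) ≠ 0 := by exact_mod_cast hc.ne'
  field_simp

theorem velocitySymbol_smul (k : Fin 2) {c : ℝ} (hc : 0 < c) (ξ : Plane) :
    velocitySymbol k (c • ξ) = velocitySymbol k ξ := by
  fin_cases k
  · exact partialSymbol_mul_fracLaplacianSymbol_smul 1 hc ξ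
  · simpa [velocitySymbol] using partialSymbol_mul_fracLaplacianSymbol_smul 0 hc ξ

theorem fracLaplacianSymbol_mul_neg (α : ℝ) {ξ : Plane} (hξ : ξ ≠ 0) :
    fracLaplacianSymbol α ξ * fracLaplacianSymbol (-α) ξ = 1 := by
  have hπ := Real.pi_pos
  have hn : 0 < 2 * Real.pi * ‖ξ‖ := by positivity
  rw [fracLaplacianSymbol, fracLaplacianSymbol, ← Complex.ofReal_mul, ← Real.rpow_add hn]
  simp

theorem hasTemperateGrowth_partialSymbol (k : Fin 2) : (partialSymbol k).HasTemperateGrowth := by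
  have : partialSymbol k = fun ξ : Plane => 2 * Real.pi * Complex.I *
      Complex.ofRealCLM ((EuclideanSpace.proj k : Plane →L[ℝ] ℝ) ξ) := rfl
  rw [this]
  fun_prop

theorem lineDeriv_eq_partialSymbol (k : Fin 2) (u : 𝓢'(Plane, ℂ)) :
    ∂_{EuclideanSpace.single k (1 : ℝ)} u =
      TemperedDistribution.fourierMultiplierCLM ℂ (partialSymbol k) u := by
  rw [TemperedDistribution.lineDeriv_eq_fourierMultiplierCLM]
  have h : partialSymbol k = (2 * Real.pi * Complex.I) •
      (fun ξ : Plane => ((inner ℝ ξ (EuclideanSpace.single k (1 : ℝ)) : ℝ) : ℂ)) := by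
    funext ξ
    simp [partialSymbol, EuclideanSpace.inner_single_right]
  rw [h, TemperedDistribution.fourierMultiplierCLM_smul (by fun_prop)]
  rfl

theorem IsMultiplier.unique {φ : LittlewoodPaley} {m : Plane → ℂ} {u w w' : 𝓢'(Plane, ℂ)}
    (h : IsMultiplier φ m u w) (h' : IsMultiplier φ m u w') : w = w' := HasSum.unique h h'

theorem IsMultiplier.sub {φ : LittlewoodPaley} {m : Plane → ℂ} {u u' w w' : 𝓢'(Plane, ℂ)}
    (h : IsMultiplier φ m u w) (h' : IsMultiplier φ m u' w') :
    IsMultiplier φ m (u - u') (w - w') := by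
  unfold IsMultiplier
  simp only [φ.localized_sub]
  exact HasSum.sub h h'

/-- A composition of multipliers whose product `P` is smooth at the origin. -/
theorem localized_of_isMultiplier (φ : LittlewoodPaley) {a m P : Plane → ℂ}
    (ha : ContDiffOn ℝ ∞ a {0}ᶜ) (hm : ContDiffOn ℝ ∞ m {0}ᶜ) (hP : P.HasTemperateGrowth)
    (h : ∀ ξ, ξ ≠ 0 → a ξ * m ξ = P ξ) {u w : 𝓢'(Plane, ℂ)}
    (hu : HasSum (fun j => φ.block j u) u) (hw : IsMultiplier φ m u w) (j : ℤ) :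
    φ.localized a j w = TemperedDistribution.fourierMultiplierCLM ℂ P (φ.block j u) := by
  have h1 := φ.hasSum_localized hw a j
  have h2 := (TemperedDistribution.fourierMultiplierCLM ℂ P).hasSum (φ.hasSum_block hu j)
  have e : ∀ l, φ.localized a j (φ.localized m l u) =
      TemperedDistribution.fourierMultiplierCLM ℂ P (φ.block j (φ.block l u)) := by
    intro l
    unfold localized block
    rw [fourierMultiplierCLM_comp_eq (φ.hasTemperateGrowth_mul_symbol j ha)
        (φ.hasTemperateGrowth_mul_symbol l hm)
        (m := fun ξ => P ξ * (φ.symbol j ξ * φ.symbol l ξ)) (fun ξ => ?_),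
      fourierMultiplierCLM_comp_eq (φ.hasTemperateGrowth_symbol j) (φ.hasTemperateGrowth_symbol l)
        (m := φ.symbol j * φ.symbol l) (fun ξ => rfl),
      fourierMultiplierCLM_comp_eq hP ((φ.hasTemperateGrowth_symbol j).mul
        (φ.hasTemperateGrowth_symbol l))
        (m := fun ξ => P ξ * (φ.symbol j ξ * φ.symbol l ξ)) (fun ξ => rfl)]
    -- At the origin `a * m` need not equal `P`, but `φ̂_j` vanishes there.
    by_cases hξ : ξ = 0
    · have : φ.symbol j ξ = 0 := φ.symbol_eq_zero j (Or.inl (by rw [hξ, norm_zero]; positivity))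
      rw [this]
      ring
    · rw [← h ξ hξ]
      ring
  simp only [e] at h1
  exact h1.unique h2

theorem localized_fourierMultiplierCLM (φ : LittlewoodPaley) {a m P : Plane → ℂ}
    (ha : ContDiffOn ℝ ∞ a {0}ᶜ) (hP : P.HasTemperateGrowth) (h : ∀ ξ, m ξ = P ξ * a ξ)
    (u : 𝓢'(Plane, ℂ)) (j : ℤ) :
    φ.localized a j (TemperedDistribution.fourierMultiplierCLM ℂ P u) = φ.localized m j u :=
  fourierMultiplierCLM_comp_eq (φ.hasTemperateGrowth_mul_symbol j ha) hP
    (fun ξ => by rw [h]; ring) u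

/-- The symbol of `∂_k (-Δ)^{-1/2}`. -/
noncomputable def rieszSymbol (k : Fin 2) (ξ : Plane) : ℂ :=
  partialSymbol k ξ * fracLaplacianSymbol (-(1 / 2)) ξ

theorem contDiffOn_rieszSymbol (k : Fin 2) : ContDiffOn ℝ ∞ (rieszSymbol k) {0}ᶜ :=
  (contDiff_partialSymbol k).contDiffOn.mul (contDiffOn_fracLaplacianSymbol _)

/-- The weak form of the equation as an identity between distributions. -/
theorem weak_form_iff (Λ f : 𝓢'(Plane, ℂ)) (Θ : Lp ℂ ⊤ (volume : Measure Plane))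
    (V : Fin 2 → Lp ℂ ⊤ (volume : Measure Plane)) :
    (∀ g : 𝓢(Plane, ℂ),
      Λ g - ∫ x, Θ x * ∑ k, V k x * (∂_{EuclideanSpace.single k (1 : ℝ)} g) x = f g) ↔
    Λ + ∑ k, TemperedDistribution.fourierMultiplierCLM ℂ (partialSymbol k)
      (lpMul ⊤ Θ (V k) : 𝓢'(Plane, ℂ)) = f := by
  have key : ∀ g : 𝓢(Plane, ℂ),
      (Λ + ∑ k, TemperedDistribution.fourierMultiplierCLM ℂ (partialSymbol k)
        (lpMul ⊤ Θ (V k) : 𝓢'(Plane, ℂ))) g =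
      Λ g - ∫ x, Θ x * ∑ k, V k x * (∂_{EuclideanSpace.single k (1 : ℝ)} g) x := by
    intro g
    have h1 : ∀ k : Fin 2, TemperedDistribution.fourierMultiplierCLM ℂ (partialSymbol k)
        (lpMul ⊤ Θ (V k) : 𝓢'(Plane, ℂ)) g =
        -∫ x, Θ x * (V k x * (∂_{EuclideanSpace.single k (1 : ℝ)} g) x) := by
      intro k
      rw [← lineDeriv_eq_partialSymbol, TemperedDistribution.lineDerivOp_apply_apply, map_neg,
        Lp.toTemperedDistribution_apply]
      congr 1
      refine integral_congr_ae ?_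
      filter_upwards [coeFn_lpMul Θ (V k)] with x hx
      rw [hx, smul_eq_mul]
      ring
    have hint : ∀ k : Fin 2, Integrable
        (fun x => Θ x * (V k x * (∂_{EuclideanSpace.single k (1 : ℝ)} g) x)) volume := by
      intro k
      have hb := (Lp.memLp (lpMul ⊤ Θ (V k)))
      have hg : MemLp (∂_{EuclideanSpace.single k (1 : ℝ)} g : 𝓢(Plane, ℂ)) 1 volume :=
        SchwartzMap.memLp _ 1 volume
      have := (memLp_one_iff_integrable.mp (hg.mul (r := 1) hb))
      refine this.congr ?_
      filter_upwards [coeFn_lpMul Θ (V k)] with x hx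
      rw [Pi.mul_apply, hx, mul_assoc]
    simp only [Fin.sum_univ_two, mul_add, integral_add (hint 0) (hint 1)] at h1 ⊢
    change Λ g + (TemperedDistribution.fourierMultiplierCLM ℂ (partialSymbol 0)
        (lpMul ⊤ Θ (V 0) : 𝓢'(Plane, ℂ)) g + TemperedDistribution.fourierMultiplierCLM ℂ
        (partialSymbol 1) (lpMul ⊤ Θ (V 1) : 𝓢'(Plane, ℂ)) g) = _
    rw [h1, h1]
    ring
  constructor
  · intro h
    ext g
    rw [key, h]
  · intro h g
    rw [← key, h]

variable {φ : LittlewoodPaley}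

/-- Solving the equation is the same as solving the integral equation
`θ = (-Δ)^{-1/2} f - ∑ₖ ∂ₖ (-Δ)^{-1/2} (θ vₖ)`. -/
theorem isQGSolution_iff {f θ y : 𝓢'(Plane, ℂ)} (hf : HasSum (fun j => φ.block j f) f)
    (hθ : HasSum (fun j => φ.block j θ) θ)
    (hy : IsMultiplier φ (fracLaplacianSymbol (-(1 / 2))) f y)
    {Θ : Lp ℂ ⊤ (volume : Measure Plane)} {V : Fin 2 → Lp ℂ ⊤ (volume : Measure Plane)}
    (hΘ : (Θ : 𝓢'(Plane, ℂ)) = θ)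
    (hV : ∀ k, IsMultiplier φ (velocitySymbol k) θ (V k : 𝓢'(Plane, ℂ)))
    (hW : ∀ k, HasSum (fun j => φ.block j (lpMul ⊤ Θ (V k) : 𝓢'(Plane, ℂ)))
      (lpMul ⊤ Θ (V k) : 𝓢'(Plane, ℂ)))
    {z : Fin 2 → 𝓢'(Plane, ℂ)}
    (hz : ∀ k, IsMultiplier φ (rieszSymbol k) (lpMul ⊤ Θ (V k) : 𝓢'(Plane, ℂ)) (z k)) :
    IsQGSolution φ (1 / 2) f θ ↔ θ = y - ∑ k, z k := by
  have hinv := contDiffOn_fracLaplacianSymbol (-(1 / 2))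
  have hlap := contDiffOn_fracLaplacianSymbol (1 / 2)
  have h1 : (fun _ : Plane => (1 : ℂ)).HasTemperateGrowth := Function.HasTemperateGrowth.const 1
  constructor
  · rintro ⟨Λ, Θ', V', hΛ, hΘ', hV', heq⟩
    obtain rfl : Θ' = Θ := toTemperedDistribution_injective (hΘ'.trans hΘ.symm)
    obtain rfl : V' = V := funext fun k =>
      toTemperedDistribution_injective ((hV' k).unique (hV k))
    rw [weak_form_iff, ← eq_sub_iff_add_eq] at heq
    -- Apply `(-Δ)^{-1/2}` to the equation at each frequency scale, where it is a regular
    -- multiplier; summing over `j` then gives the integral equation.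
    have hblock : ∀ j, φ.block j θ = φ.localized (fracLaplacianSymbol (-(1 / 2))) j f -
        ∑ k, φ.localized (rieszSymbol k) j (lpMul ⊤ Θ' (V' k) : 𝓢'(Plane, ℂ)) := by
      intro j
      have e := localized_of_isMultiplier φ hinv hlap h1
        (fun ξ hξ => by rw [mul_comm, fracLaplacianSymbol_mul_neg _ hξ]) hθ hΛ j
      rw [TemperedDistribution.fourierMultiplierCLM_const, one_smul] at e
      rw [← ContinuousLinearMap.id_apply (R₁ := ℂ) (φ.block j θ), ← e, heq, φ.localized_sub,
        φ.localized_sum]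
      congr 1
      exact Finset.sum_congr rfl fun k _ => localized_fourierMultiplierCLM φ hinv
        (hasTemperateGrowth_partialSymbol k) (fun ξ => rfl) _ j
    have hs : HasSum (fun j => φ.block j θ) (y - ∑ k, z k) := by
      simp only [hblock]
      exact HasSum.sub hy (hasSum_sum fun k _ => hz k)
    exact hθ.unique hs
  · intro h
    -- The equation dictates `Λ`. It is indeed `(-Δ)^{1/2} θ`: localized pieces of `(-Δ)^{1/2} y`
    -- and `(-Δ)^{1/2} z k` are the blocks of `f` and the `k`-th derivatives of the blocks of `θ
    -- vₖ`, and these sum up by `hf` and `hW`.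
    refine ⟨f - ∑ k, TemperedDistribution.fourierMultiplierCLM ℂ (partialSymbol k)
      (lpMul ⊤ Θ (V k) : 𝓢'(Plane, ℂ)), Θ, V, ?_, hΘ, hV, ?_⟩
    · have e1 : ∀ j, φ.localized (fracLaplacianSymbol (1 / 2)) j y = φ.block j f := by
        intro j
        rw [localized_of_isMultiplier φ hlap hinv h1
          (fun ξ hξ => fracLaplacianSymbol_mul_neg _ hξ) hf hy j,
          TemperedDistribution.fourierMultiplierCLM_const, one_smul]
        rfl
      have e2 : ∀ k j, φ.localized (fracLaplacianSymbol (1 / 2)) j (z k) =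
          TemperedDistribution.fourierMultiplierCLM ℂ (partialSymbol k)
            (φ.block j (lpMul ⊤ Θ (V k) : 𝓢'(Plane, ℂ))) := fun k j =>
        localized_of_isMultiplier φ hlap (contDiffOn_rieszSymbol k)
          (hasTemperateGrowth_partialSymbol k)
          (fun ξ hξ => by
            rw [rieszSymbol, mul_left_comm, fracLaplacianSymbol_mul_neg _ hξ, mul_one])
          (hW k) (hz k) j
      unfold IsMultiplier
      rw [h]
      simp only [φ.localized_sub, φ.localized_sum, e1, e2]
      exact hf.sub (hasSum_sum fun k _ => ContinuousLinearMap.hasSum _ (hW k))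
    · rw [weak_form_iff, sub_add_cancel]

end QuasiGeostrophic

/-! ### The operators of the fixed point equation on the Besov space -/

section Operators

open LittlewoodPaley

variable (φ : LittlewoodPaley) {p : ℝ≥0∞} [Fact (1 ≤ p)]

/-- A multiplier with a homogeneous symbol of degree zero acts on the Besov space. -/
theorem exists_multiplier_map (hp : p ≠ ⊤) {m : Plane → ℂ} (hm : ContDiffOn ℝ ∞ m {0}ᶜ)
    (hd : ∀ c : ℝ, 0 < c → ∀ ξ, m (c • ξ) = m ξ) :
    ∃ (T : BesovSpace φ p → BesovSpace φ p) (C : ℝ≥0),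
      (∀ u, IsMultiplier φ m u.toDist (T u).toDist) ∧
      (∀ u v, T (u - v) = T u - T v) ∧ ∀ u, ‖T u‖ ≤ C * ‖u‖ := by
  obtain ⟨C, hC⟩ := exists_isMultiplier φ hp hm (d := 0)
    (fun c hc ξ => by rw [hd c hc, Real.rpow_zero, Complex.ofReal_one, one_mul])
  simp only [zero_add] at hC
  choose w hw hmem hle using fun u : BesovSpace φ p => hC u.toDist u.memBesov
  refine ⟨fun u => .mk (w u) (hmem u), C, hw, fun u v => ?_, fun u => ?_⟩
  · apply BesovSpace.toDist_injective
    rw [map_sub]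
    refine (hw (u - v)).unique ?_
    rw [map_sub]
    exact (hw u).sub (hw v)
  · rw [BesovSpace.norm_le_iff _ (by positivity), ENNReal.ofReal_mul C.coe_nonneg,
      BesovSpace.ofReal_norm_eq, ENNReal.ofReal_coe_nnreal]
    exact hle u

theorem exists_rep_top_map (hp : p ≠ ⊤) : ∃ R : BesovSpace φ p → Lp ℂ ⊤ (volume : Measure Plane),
    (∀ u, (R u : 𝓢'(Plane, ℂ)) = u.toDist) ∧ ∀ u v, R (u - v) = R u - R v := by
  obtain ⟨C, hC⟩ := exists_rep_top_of_memBesov φ hp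
  choose R hR _ using fun u : BesovSpace φ p => hC u.toDist u.memBesov
  refine ⟨R, hR, fun u v => toTemperedDistribution_injective ?_⟩
  rw [hR, toTemperedDistribution_sub, hR, hR, map_sub]

theorem lpMul_sub_left (F F' G : Lp ℂ ⊤ (volume : Measure Plane)) :
    lpMul ⊤ (F - F') G = lpMul ⊤ F G - lpMul ⊤ F' G := by
  have h := (lpMul (⊤ : ℝ≥0∞)).map_sub F F'
  rw [h]
  exact sub_apply _ _ _

theorem lpMul_sub_right (F G G' : Lp ℂ ⊤ (volume : Measure Plane)) :
    lpMul ⊤ F (G - G') = lpMul ⊤ F G - lpMul ⊤ F G' :=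
  (lpMul (⊤ : ℝ≥0∞) F).map_sub G G'

theorem exists_mul_map (hp : p ≠ ⊤) {R : BesovSpace φ p → Lp ℂ ⊤ (volume : Measure Plane)}
    (hR : ∀ u, (R u : 𝓢'(Plane, ℂ)) = u.toDist) (hRs : ∀ u v, R (u - v) = R u - R v) :
    ∃ (B : BesovSpace φ p → BesovSpace φ p → BesovSpace φ p) (C : ℝ≥0),
      (∀ u v, (B u v).toDist = (lpMul ⊤ (R u) (R v) : Lp ℂ ⊤ (volume : Measure Plane))) ∧
      (∀ u u' v, B (u - u') v = B u v - B u' v) ∧ (∀ u v v', B u (v - v') = B u v - B u v') ∧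
      ∀ u v, ‖B u v‖ ≤ C * ‖u‖ * ‖v‖ := by
  obtain ⟨C, hC⟩ := exists_besovNorm_mul_le φ hp
  have hex : ∀ u v : BesovSpace φ p, ∃ w : BesovSpace φ p,
      w.toDist = Lp.toTemperedDistribution (lpMul ⊤ (R u) (R v)) ∧ ‖w‖ ≤ C * ‖u‖ * ‖v‖ := by
    intro u v
    obtain ⟨hmem, hle⟩ := hC u.toDist v.toDist (R u) (R v) u.memBesov v.memBesov (hR u) (hR v)
    refine ⟨.mk _ hmem, BesovSpace.toDist_mk _ _, ?_⟩
    rw [BesovSpace.norm_le_iff _ (by positivity), mul_assoc, ENNReal.ofReal_mul C.coe_nonneg,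
      ENNReal.ofReal_mul (norm_nonneg _), BesovSpace.ofReal_norm_eq, BesovSpace.ofReal_norm_eq,
      ENNReal.ofReal_coe_nnreal]
    exact hle
  choose B hB hBn using hex
  have key : ∀ {F G H : Lp ℂ ⊤ (volume : Measure Plane)} {x y z : BesovSpace φ p},
      x.toDist = Lp.toTemperedDistribution F → y.toDist = Lp.toTemperedDistribution G →
      z.toDist = Lp.toTemperedDistribution H → F = G - H → x = y - z := by
    intro F G H x y z hx hy hz h
    apply BesovSpace.toDist_injective
    rw [BesovSpace.toDist.map_sub, hx, hy, hz, h, toTemperedDistribution_sub]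
  have hl : ∀ u u' v, B (u - u') v = B u v - B u' v := fun u u' v =>
    key (hB (u - u') v) (hB u v) (hB u' v)
      ((congrArg (fun F => lpMul ⊤ F (R v)) (hRs u u')).trans (lpMul_sub_left _ _ _))
  have hr : ∀ u v v', B u (v - v') = B u v - B u v' := fun u v v' =>
    key (hB u (v - v')) (hB u v) (hB u v')
      ((congrArg (lpMul ⊤ (R u)) (hRs v v')).trans (lpMul_sub_right _ _ _))
  exact ⟨B, C, hB, hl, hr, hBn⟩

/-- The equation as a quadratic equation in the Besov space. -/
theorem exists_quadratic_form (hp : p ≠ ⊤) :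
    ∃ (Q : BesovSpace φ p → BesovSpace φ p → BesovSpace φ p) (C : ℝ), 0 < C ∧
      (∀ u u' v, Q (u - u') v = Q u v - Q u' v) ∧ (∀ u v v', Q u (v - v') = Q u v - Q u v') ∧
      (∀ u v, ‖Q u v‖ ≤ C * ‖u‖ * ‖v‖) ∧
      ∀ (f : 𝓢'(Plane, ℂ)) (y u : BesovSpace φ p), HasSum (fun j => φ.block j f) f →
        IsMultiplier φ (fracLaplacianSymbol (-(1 / 2))) f y.toDist →
        (IsQGSolution φ (1 / 2) f u.toDist ↔ u = y - Q u u) := by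
  obtain ⟨R, hR, hRs⟩ := exists_rep_top_map φ hp
  obtain ⟨B, CB, hB, hBl, hBr, hBn⟩ := exists_mul_map φ hp hR hRs
  choose T CT hT hTs hTn using fun k => exists_multiplier_map φ hp
    (contDiffOn_velocitySymbol k) (fun c hc ξ => velocitySymbol_smul k hc ξ)
  choose S CS hS hSs hSn using fun k => exists_multiplier_map φ hp
    (contDiffOn_rieszSymbol k) (fun c hc ξ => partialSymbol_mul_fracLaplacianSymbol_smul k hc ξ)
  -- Here `T k` gives the velocity component, `B` is the product and `S k` is `∂ₖ(-Δ)^{-1/2}`. The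
  -- `+ 1` only makes the constant positive.
  refine ⟨fun u v => ∑ k, S k (B u (T k v)), ∑ k, (CS k * CB * CT k : ℝ) + 1, by positivity,
    fun u u' v => ?_, fun u v v' => ?_, fun u v => ?_, fun f y u hf hy => ?_⟩
  · simp only [hBl, hSs, Finset.sum_sub_distrib]
  · simp only [hTs, hBr, hSs, Finset.sum_sub_distrib]
  · have hk : ∀ k, ‖S k (B u (T k v))‖ ≤ CS k * CB * CT k * (‖u‖ * ‖v‖) := by
      intro k
      calc ‖S k (B u (T k v))‖ ≤ CS k * (CB * ‖u‖ * (CT k * ‖v‖)) := by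
            refine (hSn k _).trans ?_
            gcongr
            refine (hBn _ _).trans ?_
            gcongr
            exact hTn k v
        _ = _ := by ring
    have h0 : 0 ≤ ‖u‖ * ‖v‖ := by positivity
    calc ‖∑ k, S k (B u (T k v))‖ ≤ ∑ k, CS k * CB * CT k * (‖u‖ * ‖v‖) :=
          norm_sum_le_of_le _ fun k _ => hk k
      _ ≤ _ := by rw [← Finset.sum_mul]; linarith
  · have hV : ∀ k, IsMultiplier φ (velocitySymbol k) u.toDist (R (T k u) : 𝓢'(Plane, ℂ)) := by
      intro k
      rw [hR]
      exact hT k u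
    have hW := fun k => (B u (T k u)).memBesov.1
    have hz := fun k => hS k (B u (T k u))
    simp only [hB] at hW hz
    rw [isQGSolution_iff hf u.memBesov.1 hy (hR u) hV hW hz, ← map_sum, ← map_sub,
      BesovSpace.toDist_injective.eq_iff]

theorem exists_fracLaplacian_inverse (hp : p ≠ ⊤) : ∃ C : ℝ≥0, ∀ f : 𝓢'(Plane, ℂ),
    MemBesov φ (2 / p.toReal - 1) p f → ∃ y : BesovSpace φ p,
      IsMultiplier φ (fracLaplacianSymbol (-(1 / 2))) f y.toDist ∧
      ENNReal.ofReal ‖y‖ ≤ C * besovNorm φ (2 / p.toReal - 1) p f := by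
  obtain ⟨C, hC⟩ := exists_isMultiplier φ hp (contDiffOn_fracLaplacianSymbol (-(1 / 2)))
    (d := 2 * (-(1 / 2))) (fun c hc ξ => fracLaplacianSymbol_smul _ hc ξ)
  rw [show 2 * (-(1 / 2)) + 2 / p.toReal = 2 / p.toReal - 1 by ring] at hC
  refine ⟨C, fun f hf => ?_⟩
  obtain ⟨y, hy, hmem, hle⟩ := hC f hf
  exact ⟨.mk y hmem, hy, (BesovSpace.ofReal_norm_eq _).trans_le hle⟩

/-- Well-posedness in the Besov space for small data. -/
theorem exists_wellPosed (hp : p ≠ ⊤) :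
    ∃ δ η : ℝ, 0 < δ ∧ 0 < η ∧
      (∀ f : 𝓢'(Plane, ℂ), MemBesov φ (2 / p.toReal - 1) p f →
        besovNorm φ (2 / p.toReal - 1) p f ≤ ENNReal.ofReal δ →
        ∃ θ : 𝓢'(Plane, ℂ), MemBesov φ (2 / p.toReal) p θ ∧
          besovNorm φ (2 / p.toReal) p θ ≤ ENNReal.ofReal η ∧ IsQGSolution φ (1 / 2) f θ) ∧
      ∃ L : ℝ≥0, ∀ f₁ f₂ θ₁ θ₂ : 𝓢'(Plane, ℂ),
        MemBesov φ (2 / p.toReal - 1) p f₁ → MemBesov φ (2 / p.toReal - 1) p f₂ →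
        MemBesov φ (2 / p.toReal) p θ₁ →
        besovNorm φ (2 / p.toReal) p θ₁ ≤ ENNReal.ofReal η → IsQGSolution φ (1 / 2) f₁ θ₁ →
        MemBesov φ (2 / p.toReal) p θ₂ →
        besovNorm φ (2 / p.toReal) p θ₂ ≤ ENNReal.ofReal η → IsQGSolution φ (1 / 2) f₂ θ₂ →
        besovNorm φ (2 / p.toReal) p (θ₁ - θ₂) ≤
          L * besovNorm φ (2 / p.toReal - 1) p (f₁ - f₂) := by
  have := BesovSpace.completeSpace (φ := φ) hp
  obtain ⟨Q, C, hC, hl, hr, hQ, hiff⟩ := exists_quadratic_form φ hp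
  obtain ⟨A, hA⟩ := exists_fracLaplacian_inverse φ hp
  have hη : 0 < 1 / (4 * C) := by positivity
  -- `δ` forces `‖y‖ ≤ 1/(8C)`, with `A + 1` in place of `A` to avoid dividing by zero; `η` is the
  -- contraction radius. The constant `2 * A` combines the factor `2` from absorption with the norm
  -- bound for `(-Δ)^{-1/2}`.
  refine ⟨1 / (8 * C) / (A + 1), 1 / (4 * C), by positivity, hη, fun f hf hfδ => ?_,
    2 * A, fun f₁ f₂ θ₁ θ₂ hf₁ hf₂ hθ₁ hn₁ hs₁ hθ₂ hn₂ hs₂ => ?_⟩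
  · obtain ⟨y, hy, hyn⟩ := hA f hf
    have hy' : ‖y‖ ≤ 1 / (8 * C) := by
      rw [← ENNReal.ofReal_le_ofReal_iff (by positivity)]
      calc ENNReal.ofReal ‖y‖ ≤ A * ENNReal.ofReal (1 / (8 * C) / (A + 1)) :=
            hyn.trans (by gcongr)
        _ = ENNReal.ofReal (A * (1 / (8 * C) / (A + 1))) := by
            rw [ENNReal.ofReal_mul A.coe_nonneg, ENNReal.ofReal_coe_nnreal]
        _ ≤ ENNReal.ofReal (1 / (8 * C)) := by
            apply ENNReal.ofReal_le_ofReal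
            have hA0 := A.coe_nonneg
            rw [← mul_div_assoc, div_le_iff₀ (by positivity), mul_comm]
            have : 0 ≤ 1 / (8 * C) := by positivity
            nlinarith
    obtain ⟨u, hu, he⟩ := exists_quadratic_eq hC hl hr hQ hy'
    exact ⟨u.toDist, u.memBesov, (u.norm_le_iff hη.le).mp hu, (hiff f y u hf.1 hy).mpr he⟩
  · obtain ⟨y₁, hy₁, -⟩ := hA f₁ hf₁
    obtain ⟨y₂, hy₂, -⟩ := hA f₂ hf₂
    obtain ⟨y, hy, hyn⟩ := hA (f₁ - f₂) (hf₁.sub hf₂)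
    obtain rfl : y = y₁ - y₂ := BesovSpace.toDist_injective (by
      rw [map_sub]
      exact hy.unique (hy₁.sub hy₂))
    have h := norm_sub_le_of_quadratic_eq hC hl hr hQ
      (((BesovSpace.mk θ₁ hθ₁).norm_le_iff hη.le).mpr hn₁)
      (((BesovSpace.mk θ₂ hθ₂).norm_le_iff hη.le).mpr hn₂)
      ((hiff f₁ y₁ (.mk θ₁ hθ₁) hf₁.1 hy₁).mp hs₁) ((hiff f₂ y₂ (.mk θ₂ hθ₂) hf₂.1 hy₂).mp hs₂)
    have h' := ENNReal.ofReal_le_ofReal h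
    rw [BesovSpace.ofReal_norm_eq, map_sub, ENNReal.ofReal_mul zero_le_two,
      ENNReal.ofReal_ofNat] at h'
    refine h'.trans ?_
    rw [ENNReal.coe_mul, ENNReal.coe_ofNat, mul_assoc]
    gcongr

end Operators

/-! ### Complex conjugation of distributions -/

section Conjugation

open scoped ComplexConjugate FourierTransform

/-- Pointwise complex conjugation of Schwartz functions. -/
noncomputable def schwartzConj : 𝓢(Plane, ℂ) →L[ℝ] 𝓢(Plane, ℂ) :=
  SchwartzMap.postcompCLM (Complex.conjCLE : ℂ →L[ℝ] ℂ)

theorem schwartzConj_apply (g : 𝓢(Plane, ℂ)) (x : Plane) : schwartzConj g x = conj (g x) := rfl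

theorem schwartzConj_schwartzConj (g : 𝓢(Plane, ℂ)) : schwartzConj (schwartzConj g) = g := by
  ext x
  rw [schwartzConj_apply, schwartzConj_apply, Complex.conj_conj]

theorem schwartzConj_smul (c : ℂ) (g : 𝓢(Plane, ℂ)) :
    schwartzConj (c • g) = conj c • schwartzConj g := by
  ext x
  simp [schwartzConj_apply]

/-- Complex conjugation of tempered distributions, `g ↦ conj (u (conj g))`. -/
noncomputable def distConj (u : 𝓢'(Plane, ℂ)) : 𝓢'(Plane, ℂ) :=
  ContinuousLinearMap.toPointwiseConvergenceCLM _ _ _ _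
    { toFun := fun g => conj (u (schwartzConj g))
      map_add' := fun g h => by rw [map_add, map_add, map_add]
      map_smul' := fun c g => by
        rw [schwartzConj_smul, map_smul, smul_eq_mul, map_mul, Complex.conj_conj, RingHom.id_apply,
          smul_eq_mul]
      cont := Complex.continuous_conj.comp
        ((show Continuous u from ContinuousLinearMap.continuous u).comp schwartzConj.continuous) }

theorem distConj_apply (u : 𝓢'(Plane, ℂ)) (g : 𝓢(Plane, ℂ)) :
    distConj u g = conj (u (schwartzConj g)) := rfl

theorem distConj_distConj (u : 𝓢'(Plane, ℂ)) : distConj (distConj u) = u := by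
  ext g
  rw [distConj_apply, distConj_apply, Complex.conj_conj, schwartzConj_schwartzConj]

theorem distConj_add (u v : 𝓢'(Plane, ℂ)) : distConj (u + v) = distConj u + distConj v := by
  ext g
  change conj (u (schwartzConj g) + v (schwartzConj g)) = _
  rw [map_add]
  rfl

theorem distConj_sum {ι : Type*} (s : Finset ι) (u : ι → 𝓢'(Plane, ℂ)) :
    distConj (∑ i ∈ s, u i) = ∑ i ∈ s, distConj (u i) :=
  map_sum (AddMonoidHom.mk' distConj distConj_add) u s

theorem continuous_distConj : Continuous distConj := by
  refine PointwiseConvergenceCLM.continuous_of_continuous_eval fun g => ?_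
  exact Complex.continuous_conj.comp (continuous_eval_const (schwartzConj g))

theorem HasSum.distConj {ι : Type*} {u : ι → 𝓢'(Plane, ℂ)} {v : 𝓢'(Plane, ℂ)} (h : HasSum u v) :
    HasSum (fun i => distConj (u i)) (distConj v) :=
  h.map (AddMonoidHom.mk' _root_.distConj distConj_add) continuous_distConj

theorem isRealDistribution_iff (u : 𝓢'(Plane, ℂ)) : IsRealDistribution u ↔ distConj u = u := by
  constructor
  · intro h
    ext g
    -- The test functions `g + conj g` and `i (g - conj g)` are real; the vanishing imaginary parts
    -- of `u` on them compare the imaginary and the real parts of `u g` and `u (conj g)`.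
    have h1 := h (g + schwartzConj g) (fun x => by
      simp [schwartzConj_apply])
    have h2 := h (Complex.I • (g - schwartzConj g)) (fun x => by
      simp [schwartzConj_apply])
    rw [map_add] at h1
    rw [map_smul, map_sub] at h2
    rw [distConj_apply]
    simp at h1 h2
    apply Complex.ext
    · simp
      linarith
    · simp
      linarith
  · intro h g hg
    have e : schwartzConj g = g := by
      ext x
      rw [schwartzConj_apply, Complex.conj_eq_iff_im, hg]
    rw [← Complex.conj_eq_iff_im]
    conv_lhs => rw [← e]
    rw [← distConj_apply, h]

theorem distConj_toTemperedDistribution {q : ℝ≥0∞} [Fact (1 ≤ q)]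
    (U : Lp ℂ q (volume : Measure Plane)) :
    distConj (Lp.toTemperedDistribution U) = Lp.toTemperedDistribution (star U) := by
  ext g
  rw [distConj_apply, Lp.toTemperedDistribution_apply, Lp.toTemperedDistribution_apply,
    ← integral_conj]
  refine integral_congr_ae ?_
  filter_upwards [Lp.coeFn_star U] with x hx
  rw [hx]
  simp [schwartzConj_apply]

theorem star_lpMul (F G : Lp ℂ ⊤ (volume : Measure Plane)) :
    star (lpMul ⊤ F G) = lpMul ⊤ (star F) (star G) := by
  apply Lp.ext
  filter_upwards [Lp.coeFn_star (lpMul ⊤ F G), coeFn_lpMul F G, coeFn_lpMul (star F) (star G),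
    Lp.coeFn_star F, Lp.coeFn_star G] with x h1 h2 h3 h4 h5
  rw [h1, h3, h4, h5, Pi.star_apply, h2, Pi.star_apply, Pi.star_apply, star_mul']

theorem enorm_star_lp {q : ℝ≥0∞} (U : Lp ℂ q (volume : Measure Plane)) : ‖star U‖ₑ = ‖U‖ₑ := by
  rw [Lp.enorm_def, Lp.enorm_def]
  refine eLpNorm_congr_norm_ae ?_
  filter_upwards [Lp.coeFn_star U] with x hx
  rw [hx, Pi.star_apply, norm_star]

theorem distLpNorm_distConj {q : ℝ≥0∞} [Fact (1 ≤ q)] (u : 𝓢'(Plane, ℂ)) :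
    distLpNorm q (distConj u) = distLpNorm q u := by
  have key : ∀ v : 𝓢'(Plane, ℂ), distLpNorm q (distConj v) ≤ distLpNorm q v := by
    intro v
    refine le_iInf₂ fun U hU => ?_
    rw [← hU, distConj_toTemperedDistribution, distLpNorm_coe, enorm_star_lp]
  refine (key u).antisymm ?_
  have := key (distConj u)
  rwa [distConj_distConj] at this

theorem fourierInv_conj (f : Plane → ℂ) (ξ : Plane) :
    𝓕⁻ (fun x => conj (f x)) ξ = conj (𝓕 f ξ) := by
  rw [Real.fourierInv_eq', Real.fourier_eq', ← integral_conj]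
  congr 1
  funext x
  rw [smul_eq_mul, smul_eq_mul, map_mul, ← Complex.exp_conj]
  simp [map_ofNat]

theorem fourier_conj_neg (f : Plane → ℂ) (x : Plane) :
    𝓕 (fun ξ => conj (f (-ξ))) x = conj (𝓕 f x) := by
  rw [← fourierInv_conj, Real.fourierInv_eq_fourier_comp_neg]

/-- Conjugation commutes with multipliers with Hermitian symbols. -/
theorem distConj_fourierMultiplierCLM {m : Plane → ℂ} (hm : m.HasTemperateGrowth)
    (h : ∀ ξ, conj (m (-ξ)) = m ξ) (u : 𝓢'(Plane, ℂ)) :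
    distConj (TemperedDistribution.fourierMultiplierCLM ℂ m u) =
      TemperedDistribution.fourierMultiplierCLM ℂ m (distConj u) := by
  ext g
  rw [distConj_apply, TemperedDistribution.fourierMultiplierCLM_apply_apply,
    TemperedDistribution.fourierMultiplierCLM_apply_apply, distConj_apply]
  congr 2
  ext x
  rw [schwartzConj_apply, SchwartzMap.fourier_coe, SchwartzMap.fourier_coe, ← fourier_conj_neg]
  refine congrFun (congrArg _ (funext fun ξ => ?_)) x
  rw [SchwartzMap.smulLeftCLM_apply_apply hm, SchwartzMap.smulLeftCLM_apply_apply hm, smul_eq_mul,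
    smul_eq_mul, map_mul, h, SchwartzMap.fourierInv_coe, SchwartzMap.fourierInv_coe,
    Real.fourierInv_eq_fourier_neg g (-ξ), neg_neg, ← fourierInv_conj]
  rfl

/-! ### Hermitian symmetry of the symbols -/

section Symbols

theorem LittlewoodPaley.symbol_conj_neg (φ : LittlewoodPaley) (j : ℤ) (ξ : Plane) :
    conj (φ.symbol j (-ξ)) = φ.symbol j ξ := by
  rw [LittlewoodPaley.symbol, LittlewoodPaley.symbol, Complex.conj_ofReal]
  congr 1
  apply φ.radial
  rw [smul_neg, norm_neg]

theorem fracLaplacianSymbol_conj_neg (α : ℝ) (ξ : Plane) :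
    conj (fracLaplacianSymbol α (-ξ)) = fracLaplacianSymbol α ξ := by
  rw [fracLaplacianSymbol, fracLaplacianSymbol, Complex.conj_ofReal, norm_neg]

theorem partialSymbol_conj_neg (k : Fin 2) (ξ : Plane) :
    conj (partialSymbol k (-ξ)) = partialSymbol k ξ := by
  simp [partialSymbol, map_ofNat]

theorem velocitySymbol_conj_neg (k : Fin 2) (ξ : Plane) :
    conj (velocitySymbol k (-ξ)) = velocitySymbol k ξ := by
  unfold velocitySymbol
  rw [map_mul, fracLaplacianSymbol_conj_neg]
  congr 1
  fin_cases k
  · exact partialSymbol_conj_neg 1 ξ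
  · exact (map_neg _ _).trans (congrArg Neg.neg (partialSymbol_conj_neg 0 ξ))

end Symbols

variable {φ : LittlewoodPaley}

theorem LittlewoodPaley.block_distConj (φ : LittlewoodPaley) (j : ℤ) (u : 𝓢'(Plane, ℂ)) :
    φ.block j (distConj u) = distConj (φ.block j u) :=
  (distConj_fourierMultiplierCLM (φ.hasTemperateGrowth_symbol j) (φ.symbol_conj_neg j) u).symm

theorem IsMultiplier.distConj {m : Plane → ℂ} (hm : ContDiffOn ℝ ∞ m {0}ᶜ)
    (h : ∀ ξ, conj (m (-ξ)) = m ξ) {u w : 𝓢'(Plane, ℂ)} (hw : IsMultiplier φ m u w) :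
    IsMultiplier φ m (distConj u) (distConj w) := by
  have e : ∀ j, φ.localized m j (_root_.distConj u) = _root_.distConj (φ.localized m j u) :=
    fun j => (distConj_fourierMultiplierCLM (φ.hasTemperateGrowth_mul_symbol j hm)
      (fun ξ => by rw [map_mul, h, φ.symbol_conj_neg]) u).symm
  unfold IsMultiplier
  simp only [e]
  exact HasSum.distConj hw

theorem besovNorm_distConj {p : ℝ≥0∞} [Fact (1 ≤ p)] (s : ℝ) (u : 𝓢'(Plane, ℂ)) :
    besovNorm φ s p (distConj u) = besovNorm φ s p u := by
  simp only [besovNorm, φ.block_distConj, distLpNorm_distConj]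

theorem MemBesov.distConj {p : ℝ≥0∞} [Fact (1 ≤ p)] {s : ℝ} {u : 𝓢'(Plane, ℂ)}
    (hu : MemBesov φ s p u) : MemBesov φ s p (distConj u) := by
  refine ⟨?_, by rw [besovNorm_distConj]; exact hu.2⟩
  simp only [φ.block_distConj]
  exact hu.1.distConj

/-- All operators involved have Hermitian symbols, that is, they map real functions to real ones,
and conjugation is multiplicative, so it passes through the nonlinear term. -/
theorem IsQGSolution.distConj {α : ℝ} {f θ : 𝓢'(Plane, ℂ)} (h : IsQGSolution φ α f θ) :
    IsQGSolution φ α (distConj f) (distConj θ) := by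
  obtain ⟨Λ, Θ, V, hΛ, hΘ, hV, heq⟩ := h
  refine ⟨_root_.distConj Λ, star Θ, fun k => star (V k),
    hΛ.distConj (contDiffOn_fracLaplacianSymbol α) (fracLaplacianSymbol_conj_neg α), ?_,
    fun k => ?_, ?_⟩
  · rw [← hΘ, distConj_toTemperedDistribution]
  · rw [← distConj_toTemperedDistribution]
    exact (hV k).distConj (contDiffOn_velocitySymbol k) (velocitySymbol_conj_neg k)
  · rw [weak_form_iff] at heq ⊢
    rw [← heq, distConj_add, distConj_sum]
    congr 1
    refine Finset.sum_congr rfl fun k _ => ?_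
    rw [distConj_fourierMultiplierCLM (hasTemperateGrowth_partialSymbol k)
      (partialSymbol_conj_neg k), distConj_toTemperedDistribution, star_lpMul]

end Conjugation

/-! ### Well-posedness for small data -/

theorem theorem1p4 (φ : LittlewoodPaley) (p : ℝ≥0∞) [Fact (1 ≤ p)] (hp : p ≠ ⊤) :
    ∃ δ η : ℝ, 0 < δ ∧ 0 < η ∧
      (∀ f : 𝓢'(Plane, ℂ), MemBesov φ (2 / p.toReal - 1) p f →
        besovNorm φ (2 / p.toReal - 1) p f ≤ ENNReal.ofReal δ →
        ∃! θ : 𝓢'(Plane, ℂ), MemBesov φ (2 / p.toReal) p θ ∧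
          besovNorm φ (2 / p.toReal) p θ ≤ ENNReal.ofReal η ∧
          IsQGSolution φ (1 / 2) f θ) ∧
      (∃ L : ℝ≥0, ∀ f₁ f₂ θ₁ θ₂ : 𝓢'(Plane, ℂ),
        MemBesov φ (2 / p.toReal - 1) p f₁ →
        besovNorm φ (2 / p.toReal - 1) p f₁ ≤ ENNReal.ofReal δ →
        MemBesov φ (2 / p.toReal - 1) p f₂ →
        besovNorm φ (2 / p.toReal - 1) p f₂ ≤ ENNReal.ofReal δ →
        MemBesov φ (2 / p.toReal) p θ₁ →
        besovNorm φ (2 / p.toReal) p θ₁ ≤ ENNReal.ofReal η →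
        IsQGSolution φ (1 / 2) f₁ θ₁ →
        MemBesov φ (2 / p.toReal) p θ₂ →
        besovNorm φ (2 / p.toReal) p θ₂ ≤ ENNReal.ofReal η →
        IsQGSolution φ (1 / 2) f₂ θ₂ →
        besovNorm φ (2 / p.toReal) p (θ₁ - θ₂) ≤
          L * besovNorm φ (2 / p.toReal - 1) p (f₁ - f₂)) ∧
      (∀ f θ : 𝓢'(Plane, ℂ), MemBesov φ (2 / p.toReal - 1) p f →
        besovNorm φ (2 / p.toReal - 1) p f ≤ ENNReal.ofReal δ →
        MemBesov φ (2 / p.toReal) p θ →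
        besovNorm φ (2 / p.toReal) p θ ≤ ENNReal.ofReal η →
        IsQGSolution φ (1 / 2) f θ →
        IsRealDistribution f → IsRealDistribution θ) := by
  obtain ⟨δ, η, hδ, hη, hex, L, hL⟩ := exists_wellPosed φ hp
  -- Uniqueness is the Lipschitz estimate with equal data; the norm is definite on the Besov space.
  have huniq : ∀ f θ₁ θ₂ : 𝓢'(Plane, ℂ), MemBesov φ (2 / p.toReal - 1) p f →
      MemBesov φ (2 / p.toReal) p θ₁ → besovNorm φ (2 / p.toReal) p θ₁ ≤ ENNReal.ofReal η →
      IsQGSolution φ (1 / 2) f θ₁ → MemBesov φ (2 / p.toReal) p θ₂ →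
      besovNorm φ (2 / p.toReal) p θ₂ ≤ ENNReal.ofReal η → IsQGSolution φ (1 / 2) f θ₂ →
      θ₁ = θ₂ := by
    intro f θ₁ θ₂ hf hθ₁ hn₁ hs₁ hθ₂ hn₂ hs₂
    have h := hL f f θ₁ θ₂ hf hf hθ₁ hn₁ hs₁ hθ₂ hn₂ hs₂
    rw [sub_self, besovNorm_zero, mul_zero, nonpos_iff_eq_zero] at h
    exact sub_eq_zero.mp ((hθ₁.sub hθ₂).eq_zero_of_besovNorm_eq_zero h)
  refine ⟨δ, η, hδ, hη, fun f hf hfδ => ?_, ⟨L, fun f₁ f₂ θ₁ θ₂ hf₁ _ hf₂ _ =>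
    hL f₁ f₂ θ₁ θ₂ hf₁ hf₂⟩, fun f θ hf _ hθ hn hs hreal => ?_⟩
  · obtain ⟨θ, hθ, hn, hs⟩ := hex f hf hfδ
    exact ⟨θ, ⟨hθ, hn, hs⟩, fun θ' h' => huniq f θ' θ hf h'.1 h'.2.1 h'.2.2 hθ hn hs⟩
  -- The conjugate of `θ` has the same norm and solves the equation with the same real `f`, so it
  -- equals `θ`.
  · rw [isRealDistribution_iff] at hreal ⊢
    have hs' := hs.distConj
    rw [hreal] at hs'
    exact huniq f _ θ hf hθ.distConj (by rwa [besovNorm_distConj]) hs' hθ hn hs
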